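/- Fix a sampling period $t>0$ and let $A=\begin{bmatrix} I & tI\\ 0& I\end{bmatrix}$, $B=\begin{bmatrix}\frac12t^2I\\ tI\end{bmatrix}$ with $3\times3$ blocks. States $X=(p,v)\in\mathbb R^6$ consist of a position and a velocity. Guardians and targets. The two guardians move by $X_i(k+1)=AX_i(k)+Bu_i(k)$, $i\in\{1,2\}$, from given initial states, and the protected target ($j=1$) and the hostile target ($j=2$) by $\bar X_j(k+1)=A\bar X_j(k)+B\bar u_j(k)$, $k\ge 0$. Here $\bar u_1$ is an arbitrary stochastic process, and each $\bar u_2(k)$ has the mixture law $\gamma\,\mathcal N(0,W_1)+(1-\gamma)\,\mathcal N(0,W_2)$, with $\gamma\in(0,1]$ and $\hat w_iI\le W_i\le\check w_iI$, $\hat w_i>0$. Put $q_{12}=p_1-p_2$. Controller. Let $\beta>1$, $U>0$, $\alpha\in(-\beta^{-1},0)$, $l_3\in\mathbb R$, and let $g(d_1,d_2)=\frac1\beta\big(\frac{U(\beta-1)}{\max\{U,(d_1+d_2)/2\}}+1\big)$. Let $\zeta(k)=r(k)\,(\sin(\rho k\pi),\cos(\rho k\pi),h(k))^\top$ with a (possibly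 random) radius $r(k)$ such that almost surely, for all $k\ge0$, $\|\zeta(k)\|\le\bar r$ and $\hat a_\zeta I\le\sum_{m=k}^{k+N-1}\zeta(m)\zeta(m)^\top\le\check a_\zeta I$, with constants $\bar r$, $\hat a_\zeta>0$, $\check a_\zeta$, $N\ge1$. The guardians use $$u_i=2t^{-2}\big[(\alpha-1)\,g(\|p_1-p\|,\|p_2-p\|)\,(p_i-p)+(-1)^i(\zeta(k+1)-\alpha\zeta(k))\big]+2t^{-1}(v-v_i),$$ where $(p,v)$ is the state $\bar X_1(k)$ of the protected target if $\|\bar p_1(k)-\hat{\bar p}_2(k)\|\ge l_3$, and the current estimate $\hat{\bar X}_2(k)=(\hat{\bar p}_2(k),\hat{\bar v}_2(k))$ of the state of the hostile target otherwise. Measurements and estimator. Guardian $i$ measures $D_i=\|p_i-\bar p_2\|^2+\eta_i$ with $\eta_i(k)\sim\mathcal N(0,\sigma_i)$ (variance $\sigma_i$), $0<\hat\sigma\le\sigma_i\le\check\sigma$, and $\eta_1(k)$, $\eta_2(k)$ independent. Put $Y=-\frac12(D_1-D_2-p_1^\top p_1+p_2^\top p_2)=C\bar X_2-\frac12(\eta_1-\eta_2)$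 with $C(k)=q_{12}(k)^\top[I\ 0]$, $\Gamma_2=\frac14(\sigma_1+\sigma_2)$ and $W=\gamma W_1+(1-\gamma)W_2$. The estimator is the Kalman filter $$\hat{\bar X}_2(k)=A\hat{\bar X}_2(k-1)+K(k)\big[Y(k)-C(k)A\hat{\bar X}_2(k-1)\big],\qquad G(k|k-1)=AG(k-1)A^\top+BWB^\top,$$ $$K(k)=G(k|k-1)C(k)^\top\big[C(k)G(k|k-1)C(k)^\top+\Gamma_2\big]^{-1},\qquad G(k)=(I-K(k)C(k))\,G(k|k-1),$$ for $k\ge1$, where $G(0)$ is a given positive definite matrix. The estimation error is $\hat e_2=\bar X_2-\hat{\bar X}_2$, and $\hat e_2(0)$ is any random vector with $\mathbf E\|\hat e_2(0)\|^2<\infty$. Theorem. There are constants $M\in\mathbb Z$ with $M\ge2$, $\hat G_1,\check G_1,\check c_C>0$ and $c_\alpha\in(0,1]$, depending only on the deterministic data above ($t,\alpha,\beta,U,l_3,\rho,h,\bar r,\hat a_\zeta,\check a_\zeta,N,\gamma,W_i,\hat w_i,\check w_i,\sigma_i,\hat\sigma,\check\sigma$, the initial guardian states and $G(0)$), and not on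 the probability space, on the random processes or on the initial state or initial estimate of the hostile target, such that the following holds. Almost surely $\|q_{12}(k)\|^2\le\check c_C$ and $\hat G_1I\le G(k)^{-1}\le\check G_1I$ for all $k\ge0$. The mean-square error $\mathbf E\|\hat e_2(k)\|^2$ is finite for all $k$. With $$\tilde\varepsilon=\frac{3}{\hat c_A}\check G_1\check c_B\check c_W+\frac{\check c_C}{\hat c_\Gamma\hat G_1},\quad \hat c_A=\tfrac{2+t^2-t\sqrt{4+t^2}}2,\quad \check c_B=\tfrac14t^4+t^2,\quad \check c_W=\gamma\check w_1+(1-\gamma)\check w_2,\quad \hat c_\Gamma=\tfrac12\hat\sigma,$$ one has, for all integers $\ell\ge0$ and $k\ge\ell(M-1)$, $$\mathbf E\|\hat e_2(k)\|^2\le\Big[(1-c_\alpha)^\ell\check G_1\,\mathbf E\|\hat e_2(k-\ell(M-1))\|^2+\sum_{\imath=0}^{\ell-1}(1-c_\alpha)^\imath\tilde\varepsilon\Big]\hat G_1^{-1},$$ $$\mathbf E\|\hat e_2(k)\|^2\le\hat\varepsilon:=(1-c_\alpha)^\ell\check G_1\hat G_1^{-1}\,\mathbf E\|\hat e_2(0)\|^2+\hat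 G_1^{-1}\Big(\sum_{\imath=0}^{\ell-1}(1-c_\alpha)^\imath+M-2\Big)\tilde\varepsilon .$$ That is, the mean-square estimation error of the hostile target is exponentially bounded and converges exponentially into a region bounded by $\hat\varepsilon$. -/

import Mathlib

open MeasureTheory ProbabilityTheory Matrix
open scoped NNReal ENNReal MatrixOrder

namespace Encirclement

noncomputable section

/-- Vectors of `ℝ³` with the Euclidean norm. -/
abbrev Vec3 : Type := EuclideanSpace ℝ (Fin 3)

/-- States `(p, v) ∈ ℝ⁶`: position on the left summand, velocity on the right one. -/
abbrev State : Type := EuclideanSpace ℝ (Fin 3 ⊕ Fin 3)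

/-- Matrices acting on states. -/
abbrev StateMatrix : Type := Matrix (Fin 3 ⊕ Fin 3) (Fin 3 ⊕ Fin 3) ℝ

/-- The position part of a state. -/
def pos (X : State) : Vec3 := WithLp.toLp 2 fun i => X (Sum.inl i)

/-- The velocity part of a state. -/
def vel (X : State) : Vec3 := WithLp.toLp 2 fun i => X (Sum.inr i)

/-- `A = [I, tI; 0, I]`. -/
def sysA (t : ℝ) : StateMatrix :=
  fromBlocks 1 (t • (1 : Matrix (Fin 3) (Fin 3) ℝ)) 0 1

/-- `B = [(t²/2) I; t I]`. -/
def sysB (t : ℝ) : Matrix (Fin 3 ⊕ Fin 3) (Fin 3) ℝ :=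
  fromRows ((1 / 2 * t ^ 2) • (1 : Matrix (Fin 3) (Fin 3) ℝ)) (t • (1 : Matrix (Fin 3) (Fin 3) ℝ))

/-- One step `A X + B u` of the double integrator with sampling period `t`. -/
def motionStep (t : ℝ) (X : State) (u : Vec3) : State :=
  toEuclideanLin (sysA t) X + toEuclideanLin (sysB t) u

/-- The outer product `x xᵀ`. -/
def outer (x : Vec3) : Matrix (Fin 3) (Fin 3) ℝ := vecMulVec x.ofLp x.ofLp

/-- The encirclement shape vector `ζ(k) = r(k) (sin(ρkπ), cos(ρkπ), h(k))`. -/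
def shapeVec (ρ : ℝ) (h : ℕ → ℝ) (r : ℕ → ℝ) (k : ℕ) : Vec3 :=
  r k • !₂[Real.sin (ρ * k * Real.pi), Real.cos (ρ * k * Real.pi), h k]

/-- `ζ` is persistently exciting with constants `a₁, a₂` and window length `N`:
`a₁ I ≤ ∑_{m=k}^{k+N-1} ζ(m) ζ(m)ᵀ ≤ a₂ I` for every `k ≥ 0`. -/
def PersistentlyExciting (ζ : ℕ → Vec3) (a₁ a₂ : ℝ) (N : ℕ) : Prop :=
  ∀ k : ℕ, a₁ • (1 : Matrix (Fin 3) (Fin 3) ℝ) ≤ ∑ m ∈ Finset.range N, outer (ζ (k + m)) ∧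
    ∑ m ∈ Finset.range N, outer (ζ (k + m)) ≤ a₂ • (1 : Matrix (Fin 3) (Fin 3) ℝ)

/-- The input-limiting function
`g(d₁, d₂) = β⁻¹ (U(β - 1) / max{U, (d₁ + d₂)/2} + 1)`. -/
def limiter (β U d₁ d₂ : ℝ) : ℝ := 1 / β * (U * (β - 1) / max U ((d₁ + d₂) / 2) + 1)

/-- The deterministic design data and the standing assumptions on them.
In `Fin 2`-indexed families the index `0` stands for "1" and the index `1` for "2". -/
structure Setup where
  /-- sampling period -/
  t : ℝ
  /-- controller gain -/
  α : ℝ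
  /-- limiter parameter -/
  β : ℝ
  /-- limiter parameter -/
  U : ℝ
  /-- radius of the target protection zone: the protected target is encircled as long as the
  estimated distance between the two targets is at least `l₃` -/
  l₃ : ℝ
  /-- encirclement frequency -/
  ρ : ℝ
  /-- vertical motion function -/
  h : ℕ → ℝ
  /-- bound on the shape vector -/
  rBar : ℝ
  /-- persistent-excitation constants of the shape vector -/
  aLow : ℝ
  aHigh : ℝ
  N : ℕ
  /-- occurrence probability in the acceleration of the hostile target -/
  γ : ℝ
  /-- the two variances in the acceleration of the hostile target -/
  W : Fin 2 → Matrix (Fin 3) (Fin 3) ℝ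
  wLow : Fin 2 → ℝ
  wHigh : Fin 2 → ℝ
  /-- variances of the measurement noises of the two guardians -/
  σ : Fin 2 → ℝ≥0
  σLow : ℝ
  σHigh : ℝ
  /-- initial states of the guardians -/
  guardian₀ : Fin 2 → State
  /-- initial variance matrix of the filter -/
  G₀ : StateMatrix
  t_pos : 0 < t
  one_lt_β : 1 < β
  U_pos : 0 < U
  α_mem : α ∈ Set.Ioo (-β⁻¹) 0
  aLow_pos : 0 < aLow
  N_pos : 0 < N
  γ_mem : γ ∈ Set.Ioc (0 : ℝ) 1
  wLow_pos : ∀ i, 0 < wLow i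
  W_bounds : ∀ i, wLow i • (1 : Matrix (Fin 3) (Fin 3) ℝ) ≤ W i ∧
    W i ≤ wHigh i • (1 : Matrix (Fin 3) (Fin 3) ℝ)
  σLow_pos : 0 < σLow
  σ_bounds : ∀ i, σLow ≤ σ i ∧ (σ i : ℝ) ≤ σHigh
  G₀_posDef : G₀.PosDef

namespace Setup

variable (S : Setup)

/-- Law of the acceleration of the hostile target: the mixture
`γ N(0, W₁) + (1 - γ) N(0, W₂)`. -/
def accLaw : Measure Vec3 :=
  ENNReal.ofReal S.γ • multivariateGaussian 0 (S.W 0) +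
    ENNReal.ofReal (1 - S.γ) • multivariateGaussian 0 (S.W 1)

/-- Variance of the acceleration of the hostile target. -/
def accVar : Matrix (Fin 3) (Fin 3) ℝ := S.γ • S.W 0 + (1 - S.γ) • S.W 1

/-- `Γ₂ = (σ₁ + σ₂)/4`, the variance of the noise of the linear observation. -/
def obsVar : ℝ := 1 / 4 * ((S.σ 0 : ℝ) + S.σ 1)

/-- The observation row `C = q₁₂ᵀ [I 0]`, written as a vector. -/
def obsRow (q : Vec3) : Fin 3 ⊕ Fin 3 → ℝ := Sum.elim q.ofLp 0

/-- Predicted variance `G(k|k-1) = A G(k-1) Aᵀ + B W₂ Bᵀ`. -/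
def predVar (G : StateMatrix) : StateMatrix :=
  sysA S.t * G * (sysA S.t)ᵀ + sysB S.t * S.accVar * (sysB S.t)ᵀ

/-- Kalman gain `K = G⁻ Cᵀ (C G⁻ Cᵀ + Γ₂)⁻¹` for the predicted variance `G⁻`. -/
def gain (Gpred : StateMatrix) (C : Fin 3 ⊕ Fin 3 → ℝ) : Fin 3 ⊕ Fin 3 → ℝ :=
  (C ⬝ᵥ (Gpred *ᵥ C) + S.obsVar)⁻¹ • (Gpred *ᵥ C)

/-- The filter variance along the relative positions `q(k) = q₁₂(k)` of the guardians:
`G(0) = G₀` and `G(k) = (I - K(k) C(k)) G(k|k-1)`. -/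
def filterVar (q : ℕ → Vec3) : ℕ → StateMatrix
  | 0 => S.G₀
  | k + 1 =>
    (1 - vecMulVec (S.gain (S.predVar (filterVar q k)) (obsRow (q (k + 1))))
        (obsRow (q (k + 1)))) * S.predVar (filterVar q k)

/-- The Kalman gain `K(k + 1)` along the relative positions `q`. -/
def filterGain (q : ℕ → Vec3) (k : ℕ) : Fin 3 ⊕ Fin 3 → ℝ :=
  S.gain (S.predVar (S.filterVar q k)) (obsRow (q (k + 1)))

/-- The acceleration command of guardian `i`, tracking a target with (estimated) state `T`:
`2t⁻² ((α - 1) g(‖p₁ - p_T‖, ‖p₂ - p_T‖) (p_i - p_T) + Δζ_i(k)) + 2t⁻¹ (v_T - v_i)` with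
`Δζ_i(k) = (-1)^i (ζ(k+1) - α ζ(k))`. -/
def trackingControl (ζ : ℕ → Vec3) (X : Fin 2 → State) (T : State) (k : ℕ) (i : Fin 2) : Vec3 :=
  (2 / S.t ^ 2) •
      (((S.α - 1) * limiter S.β S.U ‖pos (X 0) - pos T‖ ‖pos (X 1) - pos T‖) •
          (pos (X i) - pos T) +
        (-1 : ℝ) ^ ((i : ℕ) + 1) • (ζ (k + 1) - S.α • ζ k)) +
    (2 / S.t) • (vel T - vel (X i))

open Classical in
/-- The anti-synchronization based controller: the protected target (true state `X₁`) is tracked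
while its distance to the estimate `Xhat` of the hostile target is at least `l₃`,
and the estimate of the hostile target is tracked otherwise. -/
def control (ζ : ℕ → Vec3) (X : Fin 2 → State) (X₁ Xhat : State) (k : ℕ) (i : Fin 2) : Vec3 :=
  if S.l₃ ≤ ‖pos X₁ - pos Xhat‖ then S.trackingControl ζ X X₁ k i
  else S.trackingControl ζ X Xhat k i

/-- `ĉ_A = (2 + t² - t √(4 + t²))/2`, the smallest eigenvalue of `A Aᵀ`. -/
def cALow : ℝ := (2 + S.t ^ 2 - S.t * Real.sqrt (4 + S.t ^ 2)) / 2

/-- `č_B = t⁴/4 + t²`, so that `Bᵀ B = č_B I`. -/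
def cBHigh : ℝ := 1 / 4 * S.t ^ 4 + S.t ^ 2

/-- `č_W = γ w̌₁ + (1 - γ) w̌₂`. -/
def cWHigh : ℝ := S.γ * S.wHigh 0 + (1 - S.γ) * S.wHigh 1

/-- `ĉ_Γ = σ̂/2`. -/
def cΓLow : ℝ := 1 / 2 * S.σLow

/-- `ε̃ = (3/ĉ_A) Ǧ₁ č_B č_W + č_C / (ĉ_Γ Ĝ₁)`. -/
def epsTilde (gLow gHigh cC : ℝ) : ℝ :=
  3 / S.cALow * gHigh * S.cBHigh * S.cWHigh + cC / (S.cΓLow * gLow)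

end Setup

/-- A closed loop on the probability space `(Ω, P)`: two guardians driven by the
anti-synchronization based controller, the protected target (index `0`), the hostile target
(index `1`), and the Kalman-filter based estimate of the state of the hostile target. -/
structure ClosedLoop (S : Setup) {Ω : Type*} [MeasurableSpace Ω] (P : Measure Ω) where
  /-- encirclement radius `r(k)` -/
  radius : ℕ → Ω → ℝ
  /-- accelerations of the two targets -/
  acc : Fin 2 → ℕ → Ω → Vec3
  /-- noises of the squared distance measurements of the two guardians -/
  noise : Fin 2 → ℕ → Ω → ℝ
  /-- states of the two guardians -/
  guardian : Fin 2 → ℕ → Ω → State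
  /-- states of the two targets -/
  target : Fin 2 → ℕ → Ω → State
  /-- estimate of the state of the hostile target -/
  estimate : ℕ → Ω → State
  radius_meas : ∀ k, Measurable (radius k)
  acc_meas : ∀ j k, Measurable (acc j k)
  noise_meas : ∀ i k, Measurable (noise i k)
  guardian_meas : ∀ i k, Measurable (guardian i k)
  target_meas : ∀ j k, Measurable (target j k)
  estimate_meas : ∀ k, Measurable (estimate k)
  acc_law : ∀ k, HasLaw (acc 1 k) S.accLaw P
  noise_law : ∀ i k, HasLaw (noise i k) (gaussianReal 0 (S.σ i)) P
  noise_indep : ∀ k, IndepFun (noise 0 k) (noise 1 k) P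
  initial_memLp : MemLp (fun ω => target 1 0 ω - estimate 0 ω) 2 P
  shape_bounded : ∀ᵐ ω ∂P, ∀ k, ‖shapeVec S.ρ S.h (fun m => radius m ω) k‖ ≤ S.rBar
  shape_pe : ∀ᵐ ω ∂P,
    PersistentlyExciting (shapeVec S.ρ S.h fun m => radius m ω) S.aLow S.aHigh S.N
  guardian_zero : ∀ i ω, guardian i 0 ω = S.guardian₀ i
  guardian_succ : ∀ i k ω, guardian i (k + 1) ω = motionStep S.t (guardian i k ω)
    (S.control (shapeVec S.ρ S.h fun m => radius m ω) (fun i' => guardian i' k ω)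
      (target 0 k ω) (estimate k ω) k i)
  target_succ : ∀ j k ω, target j (k + 1) ω = motionStep S.t (target j k ω) (acc j k ω)
  /-- `X̂(k+1) = A X̂(k) + K(k+1) (Y(k+1) - C(k+1) A X̂(k))`, where the observation `Y` is
  `-½ (D₁ - D₂ - p₁ᵀp₁ + p₂ᵀp₂)` for the measured squared distances
  `D_i = ‖p_i - p̄₂‖² + η_i`. -/
  estimate_succ : ∀ k ω, estimate (k + 1) ω =
    toEuclideanLin (sysA S.t) (estimate k ω) +
      ((-(1 / 2) *
          ((‖pos (guardian 0 (k + 1) ω) - pos (target 1 (k + 1) ω)‖ ^ 2 + noise 0 (k + 1) ω) -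
            (‖pos (guardian 1 (k + 1) ω) - pos (target 1 (k + 1) ω)‖ ^ 2 + noise 1 (k + 1) ω) -
            ‖pos (guardian 0 (k + 1) ω)‖ ^ 2 + ‖pos (guardian 1 (k + 1) ω)‖ ^ 2)) -
        Setup.obsRow (pos (guardian 0 (k + 1) ω) - pos (guardian 1 (k + 1) ω)) ⬝ᵥ
          (toEuclideanLin (sysA S.t) (estimate k ω)).ofLp) •
      WithLp.toLp 2
        (S.filterGain (fun m => pos (guardian 0 m ω) - pos (guardian 1 m ω)) k)

namespace ClosedLoop

variable {S : Setup} {Ω : Type*} [MeasurableSpace Ω] {P : Measure Ω} (L : ClosedLoop S P)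

/-- Relative position `q₁₂(k)` of the guardians. -/
def relPos (k : ℕ) (ω : Ω) : Vec3 := pos (L.guardian 0 k ω) - pos (L.guardian 1 k ω)

/-- The variance matrix `G(k)` of the filter. -/
def var (k : ℕ) (ω : Ω) : StateMatrix := S.filterVar (fun m => L.relPos m ω) k

/-- State estimation error of the hostile target. -/
def err (k : ℕ) (ω : Ω) : State := L.target 1 k ω - L.estimate k ω

/-- Mean-square state estimation error of the hostile target. -/
def meanSqErr (k : ℕ) : ℝ := ∫ ω, ‖L.err k ω‖ ^ 2 ∂P

end ClosedLoop

end

end Encirclement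

/-!
The argument is pathwise: all inequalities for the filter and its error hold along almost every
trajectory, and expectations are taken once, at the very end.

*Cost-to-arrive.* Let `V_k(X) = Xᵀ G(k)⁻¹ X`. The Riccati recursion says that `V_k(X)` is the least
value of `V_0(X₀) + ∑ (uᵀ W⁻¹ u + (C X)² / Γ₂)` over all trajectories of the double integrator that
end in `X` at time `k` (`Setup.predLyap_motionStep_le`, `Setup.exists_predLyap_eq`,
`Setup.lyap_succ`). Completing the square in the measurement update shows that along the error
dynamics, with acceleration `u`, observation noise `ν` and innovation `ι` of nominal variance `s`,
`V_{k+1}(e_{k+1}) ≤ V_k(e_k) + uᵀ W⁻¹ u + ν² / Γ₂ - ι² / s` (`Setup.lyap_succ_correct_le`).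

*Excitation.* The relative position obeys `q⁺ = f q - 2 (ζ⁺ - α ζ)` with `|f| ≤ φ < 1`, whichever
target is tracked and wherever it is, so it is bounded. If it were almost orthogonal to a direction
`y` during a long window, then `⟨ζ⁺, y⟩ ≈ α ⟨ζ, y⟩` there, and `⟨ζ, y⟩` would decay, against
persistent excitation (`exists_le_abs_inner_of_persistentlyExciting`). An unforced position moves
on a line, whose direction of view turns ever more slowly; hence the outputs `⟨q, p⟩` over a long
window determine position and velocity, with uniform constants
(`exists_norm_sq_le_sum_outputs`).

*Bounds and contraction.* Steering to a state in two steps bounds `V_k` from above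
(`Setup.exists_lyap_le`); observability along a cheapest trajectory that ends in the state
bounds it from below (`Setup.exists_lyap_ge`). In the error dynamics the outputs are bounded by
`ν` and `ι`, so observability bounds `V_k(e_k)` by the energies of `u`, `ν`, `ι` over a window, and
the loss `ι² / s` turns into a factor `1 - c` (`Setup.exists_contraction`).

*Expectation.* The pathwise inequalities are linear in `‖e‖²`, `‖u‖²`, `ν²`, and the latter two have
bounded second moments, which gives the mean-square bounds (`integral_le_geom`). The window length
is `M - 1`; since `Ĝ₁` may be lowered, `ε̃` may be taken to dominate the accumulated mean
energy of the disturbances.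
-/

namespace Encirclement

noncomputable section

/-! ### Quadratic forms of the Kalman recursion -/

section Riccati

variable {n m : Type*} [Fintype n] [Fintype m]

lemma dotProduct_mulVec_symm {G : Matrix n n ℝ} (hG : G.IsHermitian) (x y : n → ℝ) :
    x ⬝ᵥ G *ᵥ y = y ⬝ᵥ G *ᵥ x := by
  have h : Gᵀ = G := by simpa [conjTranspose_eq_transpose_of_trivial] using hG.eq
  rw [dotProduct_mulVec, ← mulVec_transpose, h, dotProduct_comm]

lemma quadForm_nonneg {G : Matrix n n ℝ} (hG : G.PosSemidef) (x : n → ℝ) :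
    0 ≤ x ⬝ᵥ G *ᵥ x := by
  simpa using hG.dotProduct_mulVec_nonneg x

lemma quadForm_propagate (A : Matrix n n ℝ) (B : Matrix n m ℝ) (G : Matrix n n ℝ)
    (W : Matrix m m ℝ) (y : n → ℝ) :
    y ⬝ᵥ (A * G * Aᵀ + B * W * Bᵀ) *ᵥ y =
      (Aᵀ *ᵥ y) ⬝ᵥ G *ᵥ (Aᵀ *ᵥ y) + (Bᵀ *ᵥ y) ⬝ᵥ W *ᵥ (Bᵀ *ᵥ y) := by
  rw [add_mulVec, dotProduct_add, ← mulVec_mulVec, ← mulVec_mulVec, ← mulVec_mulVec,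
    ← mulVec_mulVec, dotProduct_mulVec y A, dotProduct_mulVec y B, ← mulVec_transpose,
    ← mulVec_transpose]

lemma innovation_pos {P : Matrix n n ℝ} (hP : P.PosDef) (C : n → ℝ) {Γ : ℝ} (hΓ : 0 < Γ) :
    0 < C ⬝ᵥ P *ᵥ C + Γ := by
  have := quadForm_nonneg hP.posSemidef C
  linarith

lemma dotProduct_gain {P : Matrix n n ℝ} (hP : P.PosDef) (C : n → ℝ) {Γ : ℝ} (hΓ : 0 < Γ) :
    C ⬝ᵥ ((C ⬝ᵥ P *ᵥ C + Γ)⁻¹ • (P *ᵥ C)) = 1 - Γ / (C ⬝ᵥ P *ᵥ C + Γ) := by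
  have hs := innovation_pos hP C hΓ
  rw [dotProduct_smul, smul_eq_mul]
  field_simp
  ring

variable [DecidableEq n]

lemma inv_mulVec_mulVec {G : Matrix n n ℝ} (hG : G.PosDef) (x : n → ℝ) :
    G⁻¹ *ᵥ (G *ᵥ x) = x := by
  rw [mulVec_mulVec, nonsing_inv_mul _ ((isUnit_iff_isUnit_det _).1 hG.isUnit), one_mulVec]

lemma mulVec_inv_mulVec {G : Matrix n n ℝ} (hG : G.PosDef) (x : n → ℝ) :
    G *ᵥ (G⁻¹ *ᵥ x) = x := by
  rw [mulVec_mulVec, mul_nonsing_inv _ ((isUnit_iff_isUnit_det _).1 hG.isUnit), one_mulVec]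

/-- Young's inequality for the dual quadratic forms of `G` and `G⁻¹`. -/
lemma two_mul_dotProduct_le {G : Matrix n n ℝ} (hG : G.PosDef) (z e : n → ℝ) :
    2 * (z ⬝ᵥ e) ≤ e ⬝ᵥ G⁻¹ *ᵥ e + z ⬝ᵥ G *ᵥ z := by
  have h := quadForm_nonneg hG.inv.posSemidef (e - G *ᵥ z)
  rw [mulVec_sub, inv_mulVec_mulVec hG, sub_dotProduct, dotProduct_sub, dotProduct_sub,
    dotProduct_mulVec_symm hG.inv.isHermitian (G *ᵥ z) e, inv_mulVec_mulVec hG,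
    dotProduct_comm e z, dotProduct_comm (G *ᵥ z) z] at h
  linarith

lemma propagate_posDef {A : Matrix n n ℝ} (hA : IsUnit A) (B : Matrix n m ℝ)
    {G : Matrix n n ℝ} {W : Matrix m m ℝ} (hG : G.PosDef) (hW : W.PosDef) :
    (A * G * Aᵀ + B * W * Bᵀ).PosDef := by
  refine PosDef.add_posSemidef ?_ ?_
  · have := hG.mul_mul_conjTranspose_same (B := A) (vecMul_injective_of_isUnit hA)
    rwa [conjTranspose_eq_transpose_of_trivial] at this
  · have := hW.posSemidef.mul_mul_conjTranspose_same B
    rwa [conjTranspose_eq_transpose_of_trivial] at this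

variable [DecidableEq m]

/-- The predicted variance yields the least cost of reaching a state in one step: it is
at most the cost of any pair of a starting point and an input that reaches it. -/
lemma quadForm_inv_propagate_le {A : Matrix n n ℝ} (hA : IsUnit A) (B : Matrix n m ℝ)
    {G : Matrix n n ℝ} {W : Matrix m m ℝ} (hG : G.PosDef) (hW : W.PosDef)
    (e : n → ℝ) (u : m → ℝ) :
    (A *ᵥ e + B *ᵥ u) ⬝ᵥ (A * G * Aᵀ + B * W * Bᵀ)⁻¹ *ᵥ (A *ᵥ e + B *ᵥ u) ≤
      e ⬝ᵥ G⁻¹ *ᵥ e + u ⬝ᵥ W⁻¹ *ᵥ u := by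
  have hP := propagate_posDef hA B hG hW
  set P := A * G * Aᵀ + B * W * Bᵀ with hPdef
  set x := A *ᵥ e + B *ᵥ u with hx
  set y := P⁻¹ *ᵥ x with hy
  have h1 := two_mul_dotProduct_le hG (Aᵀ *ᵥ y) e
  have h2 := two_mul_dotProduct_le hW (Bᵀ *ᵥ y) u
  have h3 := quadForm_propagate A B G W y
  rw [← hPdef, hy, mulVec_inv_mulVec hP, ← hy] at h3
  have h4 : y ⬝ᵥ x = (Aᵀ *ᵥ y) ⬝ᵥ e + (Bᵀ *ᵥ y) ⬝ᵥ u := by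
    rw [hx, dotProduct_add, dotProduct_mulVec, dotProduct_mulVec, ← mulVec_transpose,
      ← mulVec_transpose]
  rw [dotProduct_comm x y]
  linarith

/-- The least one-step cost is attained. -/
lemma exists_quadForm_inv_propagate_eq {A : Matrix n n ℝ} (hA : IsUnit A) (B : Matrix n m ℝ)
    {G : Matrix n n ℝ} {W : Matrix m m ℝ} (hG : G.PosDef) (hW : W.PosDef) (x : n → ℝ) :
    ∃ e u, x = A *ᵥ e + B *ᵥ u ∧
      x ⬝ᵥ (A * G * Aᵀ + B * W * Bᵀ)⁻¹ *ᵥ x = e ⬝ᵥ G⁻¹ *ᵥ e + u ⬝ᵥ W⁻¹ *ᵥ u := by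
  have hP := propagate_posDef hA B hG hW
  set P := A * G * Aᵀ + B * W * Bᵀ with hPdef
  set y := P⁻¹ *ᵥ x with hy
  have h3 := quadForm_propagate A B G W y
  rw [← hPdef, hy, mulVec_inv_mulVec hP, ← hy] at h3
  refine ⟨G *ᵥ (Aᵀ *ᵥ y), W *ᵥ (Bᵀ *ᵥ y), ?_, ?_⟩
  · have : P *ᵥ y = x := mulVec_inv_mulVec hP x
    rw [← this, hPdef, add_mulVec]
    simp only [mulVec_mulVec, Matrix.mul_assoc]
  · rw [inv_mulVec_mulVec hG, inv_mulVec_mulVec hW, dotProduct_comm x y, h3,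
      dotProduct_comm (G *ᵥ _), dotProduct_comm (W *ᵥ _)]

section Update

variable {P : Matrix n n ℝ} (hP : P.PosDef) (C : n → ℝ) {Γ : ℝ} (hΓ : 0 < Γ)

include hP hΓ

/-- Information form of the measurement update. -/
lemma inv_update :
    ((1 - vecMulVec ((C ⬝ᵥ P *ᵥ C + Γ)⁻¹ • (P *ᵥ C)) C) * P)⁻¹ =
      P⁻¹ + Γ⁻¹ • vecMulVec C C := by
  have hs := innovation_pos hP C hΓ
  apply inv_eq_right_inv
  set s := C ⬝ᵥ P *ᵥ C + Γ with hsdef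
  have hPP : P * P⁻¹ = 1 := mul_nonsing_inv _ ((isUnit_iff_isUnit_det _).1 hP.isUnit)
  rw [Matrix.mul_assoc, Matrix.mul_add, hPP, Matrix.mul_smul, mul_vecMulVec, Matrix.mul_add,
    Matrix.mul_one, Matrix.mul_smul, Matrix.sub_mul, Matrix.one_mul, vecMulVec_mul_vecMulVec]
  have hc : C ⬝ᵥ P *ᵥ C = s - Γ := by rw [hsdef]; ring
  rw [hc]
  ext i j
  simp only [Matrix.add_apply, Matrix.sub_apply, Matrix.smul_apply, vecMulVec_apply,
    Pi.smul_apply, smul_eq_mul]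
  field_simp
  ring

lemma update_posDef :
    ((1 - vecMulVec ((C ⬝ᵥ P *ᵥ C + Γ)⁻¹ • (P *ᵥ C)) C) * P).PosDef := by
  rw [← posDef_inv_iff, inv_update hP C hΓ]
  refine hP.inv.add_posSemidef (PosSemidef.smul ?_ (inv_nonneg.2 hΓ.le))
  simpa using posSemidef_vecMulVec_self_star C

lemma quadForm_inv_update (x : n → ℝ) :
    x ⬝ᵥ ((1 - vecMulVec ((C ⬝ᵥ P *ᵥ C + Γ)⁻¹ • (P *ᵥ C)) C) * P)⁻¹ *ᵥ x =
      x ⬝ᵥ P⁻¹ *ᵥ x + (C ⬝ᵥ x) ^ 2 / Γ := by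
  rw [inv_update hP C hΓ, add_mulVec, dotProduct_add, smul_mulVec, vecMulVec_mulVec]
  simp [dotProduct_comm x C]
  ring

/-- The cost of the corrected state: the innovation `ν - C x` is paid back. -/
lemma quadForm_inv_update_gain (x : n → ℝ) (ν : ℝ) :
    (x + (ν - C ⬝ᵥ x) • ((C ⬝ᵥ P *ᵥ C + Γ)⁻¹ • (P *ᵥ C))) ⬝ᵥ
        ((1 - vecMulVec ((C ⬝ᵥ P *ᵥ C + Γ)⁻¹ • (P *ᵥ C)) C) * P)⁻¹ *ᵥ
          (x + (ν - C ⬝ᵥ x) • ((C ⬝ᵥ P *ᵥ C + Γ)⁻¹ • (P *ᵥ C))) =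
      x ⬝ᵥ P⁻¹ *ᵥ x + ν ^ 2 / Γ - (ν - C ⬝ᵥ x) ^ 2 / (C ⬝ᵥ P *ᵥ C + Γ) := by
  have hs := innovation_pos hP C hΓ
  have hK := dotProduct_gain hP C hΓ
  rw [quadForm_inv_update hP C hΓ, dotProduct_add, dotProduct_smul, hK]
  set s := C ⬝ᵥ P *ᵥ C + Γ with hsdef
  have hc : C ⬝ᵥ P *ᵥ C = s - Γ := by rw [hsdef]; ring
  set ι := ν - C ⬝ᵥ x with hι
  have hν : ν = ι + C ⬝ᵥ x := by rw [hι]; ring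
  have h1 : (x + ι • s⁻¹ • P *ᵥ C) ⬝ᵥ P⁻¹ *ᵥ (x + ι • s⁻¹ • P *ᵥ C) =
      x ⬝ᵥ P⁻¹ *ᵥ x + 2 * (ι * s⁻¹ * (C ⬝ᵥ x)) + (ι * s⁻¹) ^ 2 * (s - Γ) := by
    rw [mulVec_add, mulVec_smul, mulVec_smul, inv_mulVec_mulVec hP, add_dotProduct,
      dotProduct_add, dotProduct_add, smul_dotProduct, smul_dotProduct,
      dotProduct_mulVec_symm hP.inv.isHermitian (P *ᵥ C) x, inv_mulVec_mulVec hP]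
    simp only [dotProduct_smul, smul_dotProduct, smul_eq_mul, dotProduct_comm (P *ᵥ C) C, hc,
      dotProduct_comm x C]
    ring
  rw [h1, smul_eq_mul, hν]
  field_simp
  ring

end Update

end Riccati

/-! ### The double integrator in Euclidean norms -/

lemma pos_add (X Y : State) : pos (X + Y) = pos X + pos Y := rfl
lemma pos_sub (X Y : State) : pos (X - Y) = pos X - pos Y := rfl
lemma pos_smul (c : ℝ) (X : State) : pos (c • X) = c • pos X := rfl
lemma vel_add (X Y : State) : vel (X + Y) = vel X + vel Y := rfl

lemma norm_sq_eq_pos_add_vel (X : State) : ‖X‖ ^ 2 = ‖pos X‖ ^ 2 + ‖vel X‖ ^ 2 := by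
  simp [EuclideanSpace.real_norm_sq_eq, Fintype.sum_sum_type, pos, vel]

lemma norm_pos_le (X : State) : ‖pos X‖ ≤ ‖X‖ :=
  le_of_sq_le_sq (by nlinarith [norm_sq_eq_pos_add_vel X, sq_nonneg ‖vel X‖]) (norm_nonneg _)

lemma norm_vel_le (X : State) : ‖vel X‖ ≤ ‖X‖ :=
  le_of_sq_le_sq (by nlinarith [norm_sq_eq_pos_add_vel X, sq_nonneg ‖pos X‖]) (norm_nonneg _)

lemma norm_le_pos_add_vel (X : State) : ‖X‖ ≤ ‖pos X‖ + ‖vel X‖ :=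
  le_of_sq_le_sq
    (by nlinarith [norm_sq_eq_pos_add_vel X, norm_nonneg (pos X), norm_nonneg (vel X)])
    (by positivity)

lemma state_ext {X Y : State} (h₁ : pos X = pos Y) (h₂ : vel X = vel Y) : X = Y := by
  ext i
  rcases i with i | i
  · exact congrArg (fun v : Vec3 => v i) h₁
  · exact congrArg (fun v : Vec3 => v i) h₂

lemma motionStep_ofLp (t : ℝ) (X : State) (u : Vec3) :
    (motionStep t X u).ofLp = sysA t *ᵥ X.ofLp + sysB t *ᵥ u.ofLp := rfl

lemma pos_motionStep (t : ℝ) (X : State) (u : Vec3) :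
    pos (motionStep t X u) = pos X + t • vel X + (1 / 2 * t ^ 2) • u := by
  ext i
  simp [pos, vel, motionStep_ofLp, sysA, sysB, fromBlocks_mulVec, fromRows_mulVec,
    smul_mulVec]

lemma vel_motionStep (t : ℝ) (X : State) (u : Vec3) :
    vel (motionStep t X u) = vel X + t • u := by
  ext i
  simp [vel, motionStep_ofLp, sysA, sysB, fromBlocks_mulVec, fromRows_mulVec, smul_mulVec]

lemma obsRow_dotProduct (q : Vec3) (X : State) :
    Setup.obsRow q ⬝ᵥ X.ofLp = inner ℝ q (pos X) := by
  simp [Setup.obsRow, dotProduct, pos, PiLp.inner_apply, Fintype.sum_sum_type, mul_comm]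

lemma isUnit_sysA (t : ℝ) : IsUnit (sysA t) := by
  rw [isUnit_iff_isUnit_det, sysA, det_fromBlocks_zero₂₁]
  simp

/-! ### The cost-to-arrive of the filter -/

section QuadForm

variable {n : Type*} [Fintype n]

lemma norm_sq_eq_dotProduct (x : EuclideanSpace ℝ n) : ‖x‖ ^ 2 = x.ofLp ⬝ᵥ x.ofLp := by
  rw [EuclideanSpace.real_norm_sq_eq]
  simp [dotProduct, sq]

variable [DecidableEq n]

lemma exists_quadForm_le (H : Matrix n n ℝ) :
    ∃ c, 0 < c ∧ ∀ x : EuclideanSpace ℝ n, x.ofLp ⬝ᵥ H *ᵥ x.ofLp ≤ c * ‖x‖ ^ 2 := by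
  set T := (toEuclideanLin H).toContinuousLinearMap
  refine ⟨‖T‖ + 1, by positivity, fun x => ?_⟩
  have h : x.ofLp ⬝ᵥ H *ᵥ x.ofLp = inner ℝ (T x) x := by
    simp [T, PiLp.inner_apply, dotProduct]
  rw [h]
  have := real_inner_le_norm (T x) x
  have := T.le_opNorm x
  nlinarith [norm_nonneg x, sq_nonneg ‖x‖]

lemma exists_le_quadForm {H : Matrix n n ℝ} (hH : H.PosDef) :
    ∃ c, 0 < c ∧ ∀ x : EuclideanSpace ℝ n, c * ‖x‖ ^ 2 ≤ x.ofLp ⬝ᵥ H *ᵥ x.ofLp := by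
  obtain ⟨C, hC, h⟩ := exists_quadForm_le H⁻¹
  refine ⟨1 / C, by positivity, fun x => ?_⟩
  -- Young's inequality for the pair `x`, `C⁻¹ x`
  have h1 := two_mul_dotProduct_le hH.inv ((1 / C) • x.ofLp) x.ofLp
  rw [nonsing_inv_nonsing_inv _ ((isUnit_iff_isUnit_det _).1 hH.isUnit)] at h1
  have h2 := h x
  simp only [mulVec_smul, smul_dotProduct, dotProduct_smul, smul_eq_mul,
    ← norm_sq_eq_dotProduct] at h1
  have h3 : 1 / C * (1 / C * (x.ofLp ⬝ᵥ H⁻¹ *ᵥ x.ofLp)) ≤ 1 / C * (1 / C * (C * ‖x‖ ^ 2)) := by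
    gcongr
  have h4 : 1 / C * (1 / C * (C * ‖x‖ ^ 2)) = 1 / C * ‖x‖ ^ 2 := by field_simp
  linarith

end QuadForm

namespace Setup

variable (S : Setup)

lemma W_posDef (i : Fin 2) : (S.W i).PosDef := by
  have h := le_iff.1 (S.W_bounds i).1
  have h1 : (S.wLow i • (1 : Matrix (Fin 3) (Fin 3) ℝ)).PosDef := PosDef.one.smul (S.wLow_pos i)
  simpa using h1.add_posSemidef h

lemma accVar_posDef : S.accVar.PosDef :=
  ((S.W_posDef 0).smul S.γ_mem.1).add_posSemidef
    ((S.W_posDef 1).posSemidef.smul (sub_nonneg.2 S.γ_mem.2))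

lemma σ_pos (i : Fin 2) : 0 < (S.σ i : ℝ) := S.σLow_pos.trans_le (S.σ_bounds i).1

lemma obsVar_pos : 0 < S.obsVar := by
  have := S.σ_pos 0
  have := S.σ_pos 1
  unfold obsVar
  positivity

lemma predVar_posDef {G : StateMatrix} (hG : G.PosDef) : (S.predVar G).PosDef :=
  propagate_posDef (isUnit_sysA _) _ hG S.accVar_posDef

lemma filterVar_posDef (q : ℕ → Vec3) (k : ℕ) : (S.filterVar q k).PosDef := by
  induction k with
  | zero => exact S.G₀_posDef
  | succ k ih => exact update_posDef (S.predVar_posDef ih) _ S.obsVar_pos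

/-- The cost-to-arrive `Xᵀ G(k)⁻¹ X`: the least weighted energy of an initial state, inputs and
observation noises that account for the state `X` at time `k`. -/
def lyap (q : ℕ → Vec3) (k : ℕ) (X : State) : ℝ :=
  X.ofLp ⬝ᵥ (S.filterVar q k)⁻¹ *ᵥ X.ofLp

/-- The cost-to-arrive before the observation at time `k + 1` is used. -/
def predLyap (q : ℕ → Vec3) (k : ℕ) (X : State) : ℝ :=
  X.ofLp ⬝ᵥ (S.predVar (S.filterVar q k))⁻¹ *ᵥ X.ofLp

/-- The energy of an input, weighted by its inverse variance. -/
def inputCost (u : Vec3) : ℝ := u.ofLp ⬝ᵥ S.accVar⁻¹ *ᵥ u.ofLp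

/-- The variance of the innovation at time `k + 1`. -/
def innovVar (q : ℕ → Vec3) (k : ℕ) : ℝ :=
  obsRow (q (k + 1)) ⬝ᵥ S.predVar (S.filterVar q k) *ᵥ obsRow (q (k + 1)) + S.obsVar

/-- The Kalman gain as an element of the state space. -/
def gainVec (q : ℕ → Vec3) (k : ℕ) : State := WithLp.toLp 2 (S.filterGain q k)

variable (q : ℕ → Vec3) (k : ℕ)

lemma lyap_nonneg (X : State) : 0 ≤ S.lyap q k X :=
  quadForm_nonneg (S.filterVar_posDef q k).inv.posSemidef _

lemma inputCost_nonneg (u : Vec3) : 0 ≤ S.inputCost u :=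
  quadForm_nonneg S.accVar_posDef.inv.posSemidef _

lemma innovVar_pos : 0 < S.innovVar q k :=
  innovation_pos (S.predVar_posDef (S.filterVar_posDef q k)) _ S.obsVar_pos

lemma obsVar_le_innovVar : S.obsVar ≤ S.innovVar q k := by
  have := quadForm_nonneg (S.predVar_posDef (S.filterVar_posDef q k)).posSemidef
    (obsRow (q (k + 1)))
  unfold innovVar
  linarith

lemma predLyap_motionStep_le (e : State) (u : Vec3) :
    S.predLyap q k (motionStep S.t e u) ≤ S.lyap q k e + S.inputCost u :=
  quadForm_inv_propagate_le (isUnit_sysA _) _ (S.filterVar_posDef q k) S.accVar_posDef _ _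

lemma exists_predLyap_eq (X : State) :
    ∃ e u, X = motionStep S.t e u ∧ S.predLyap q k X = S.lyap q k e + S.inputCost u := by
  obtain ⟨e, u, h1, h2⟩ := exists_quadForm_inv_propagate_eq (isUnit_sysA S.t) (sysB S.t)
    (S.filterVar_posDef q k) S.accVar_posDef X.ofLp
  exact ⟨WithLp.toLp 2 e, WithLp.toLp 2 u, WithLp.ofLp_injective 2 h1, h2⟩

lemma lyap_succ (X : State) :
    S.lyap q (k + 1) X = S.predLyap q k X + inner ℝ (q (k + 1)) (pos X) ^ 2 / S.obsVar := by
  rw [← obsRow_dotProduct]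
  exact quadForm_inv_update (S.predVar_posDef (S.filterVar_posDef q k)) _ S.obsVar_pos _

lemma lyap_succ_motionStep_le (e : State) (u : Vec3) :
    S.lyap q (k + 1) (motionStep S.t e u) ≤ S.lyap q k e + S.inputCost u +
      inner ℝ (q (k + 1)) (pos (motionStep S.t e u)) ^ 2 / S.obsVar := by
  rw [lyap_succ]
  linarith [S.predLyap_motionStep_le q k e u]

lemma inner_gainVec :
    inner ℝ (q (k + 1)) (pos (S.gainVec q k)) = 1 - S.obsVar / S.innovVar q k := by
  rw [← obsRow_dotProduct]
  exact dotProduct_gain (S.predVar_posDef (S.filterVar_posDef q k)) _ S.obsVar_pos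

/-- One step of the error dynamics: the cost-to-arrive grows at most by the energies of the input
and of the observation noise, and it drops by that of the innovation. -/
lemma lyap_succ_correct_le (e : State) (u : Vec3) (ν : ℝ) :
    S.lyap q (k + 1) (motionStep S.t e u +
        (ν - inner ℝ (q (k + 1)) (pos (motionStep S.t e u))) • S.gainVec q k) ≤
      S.lyap q k e + S.inputCost u + ν ^ 2 / S.obsVar -
        (ν - inner ℝ (q (k + 1)) (pos (motionStep S.t e u))) ^ 2 / S.innovVar q k := by
  have h := quadForm_inv_update_gain (S.predVar_posDef (S.filterVar_posDef q k))
    (obsRow (q (k + 1))) S.obsVar_pos (motionStep S.t e u).ofLp ν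
  rw [obsRow_dotProduct] at h
  have h2 := S.predLyap_motionStep_le q k e u
  have h3 : S.lyap q (k + 1) (motionStep S.t e u +
        (ν - inner ℝ (q (k + 1)) (pos (motionStep S.t e u))) • S.gainVec q k) =
      S.predLyap q k (motionStep S.t e u) + ν ^ 2 / S.obsVar -
        (ν - inner ℝ (q (k + 1)) (pos (motionStep S.t e u))) ^ 2 / S.innovVar q k := h
  linarith

section Bounds

variable {q k} {c Q : ℝ} (hc : 0 < c) (hq : ‖q (k + 1)‖ ≤ Q)
  (h : ∀ X, c * ‖X‖ ^ 2 ≤ S.predLyap q k X)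

include hc hq h

lemma norm_predVar_obsRow_le :
    ‖(WithLp.toLp 2 (S.predVar (S.filterVar q k) *ᵥ obsRow (q (k + 1))) : State)‖ ≤ Q / c ∧
      S.innovVar q k ≤ Q ^ 2 / c + S.obsVar := by
  set y : State := WithLp.toLp 2 (S.predVar (S.filterVar q k) *ᵥ obsRow (q (k + 1))) with hy
  have h1 : S.predLyap q k y = inner ℝ (q (k + 1)) (pos y) := by
    rw [← obsRow_dotProduct, predLyap, dotProduct_comm, hy]
    simp only
    rw [inv_mulVec_mulVec (S.predVar_posDef (S.filterVar_posDef q k))]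
  have h2 : S.innovVar q k = inner ℝ (q (k + 1)) (pos y) + S.obsVar := by
    rw [← obsRow_dotProduct]; rfl
  have h3 : inner ℝ (q (k + 1)) (pos y) ≤ Q * ‖y‖ :=
    (real_inner_le_norm _ _).trans
      (mul_le_mul hq (norm_pos_le y) (norm_nonneg _) ((norm_nonneg _).trans hq))
  have h4 := h y
  have hQ : 0 ≤ Q := (norm_nonneg _).trans hq
  have h5 : ‖y‖ ≤ Q / c := by
    rw [le_div_iff₀ hc]
    by_contra! hlt
    have : 0 < ‖y‖ := by
      by_contra! h0
      have : ‖y‖ = 0 := le_antisymm h0 (norm_nonneg _)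
      rw [this] at hlt
      linarith
    nlinarith
  refine ⟨h5, ?_⟩
  rw [h2]
  have : Q * ‖y‖ ≤ Q * (Q / c) := by gcongr
  have : Q * (Q / c) = Q ^ 2 / c := by ring
  linarith

lemma norm_gainVec_le : ‖S.gainVec q k‖ ≤ Q / c / S.obsVar := by
  have h1 := (S.norm_predVar_obsRow_le hc hq h).1
  have h2 : S.gainVec q k = (S.innovVar q k)⁻¹ •
    (WithLp.toLp 2 (S.predVar (S.filterVar q k) *ᵥ obsRow (q (k + 1))) : State) := rfl
  have h3 := S.obsVar_le_innovVar q k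
  have h4 := S.innovVar_pos q k
  have hQ : 0 ≤ Q := (norm_nonneg _).trans hq
  rw [h2, norm_smul, norm_inv, Real.norm_of_nonneg h4.le, inv_mul_eq_div]
  have := S.obsVar_pos
  gcongr

end Bounds

end Setup

/-! ### Persistent excitation and uniform observability -/

/-- Quantitative excitation of a bounded sequence `q`: in every window of length `N` and for every
direction `y` some `q (k + m)` has a component of size at least `a` along `y`. -/
def Excites (q : ℕ → Vec3) (Q a : ℝ) (N : ℕ) : Prop :=
  (∀ k, ‖q k‖ ≤ Q) ∧ ∀ k y, ∃ m < N, a * ‖y‖ ≤ |inner ℝ (q (k + m)) y|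

lemma dotProduct_outer_mulVec (x y : Vec3) :
    y.ofLp ⬝ᵥ outer x *ᵥ y.ofLp = inner ℝ x y ^ 2 := by
  have h : x.ofLp ⬝ᵥ y.ofLp = inner ℝ x y := by
    simp [PiLp.inner_apply, dotProduct, mul_comm]
  rw [outer, vecMulVec_mulVec, ← h]
  simp [dotProduct_comm y.ofLp x.ofLp, sq]

lemma PersistentlyExciting.le_sum_inner_sq {ζ : ℕ → Vec3} {a₁ a₂ : ℝ} {N : ℕ}
    (h : PersistentlyExciting ζ a₁ a₂ N) (k : ℕ) (y : Vec3) :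
    a₁ * ‖y‖ ^ 2 ≤ ∑ m ∈ Finset.range N, inner ℝ (ζ (k + m)) y ^ 2 := by
  have h1 := quadForm_nonneg (le_iff.1 (h k).1) y.ofLp
  rw [sub_mulVec, dotProduct_sub, sum_mulVec, dotProduct_sum, smul_mulVec, one_mulVec,
    dotProduct_smul, smul_eq_mul, ← norm_sq_eq_dotProduct] at h1
  simp only [dotProduct_outer_mulVec] at h1
  linarith

/-- A persistently exciting `ζ` excites every solution of `q⁺ = f q - 2 (ζ⁺ - α ζ)`, whatever the
factors `f` are: were `q` almost orthogonal to `y` for long, then `⟨ζ⁺, y⟩ ≈ α ⟨ζ, y⟩`, so that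
`⟨ζ, y⟩` would decay. -/
lemma exists_le_abs_inner_of_persistentlyExciting {α : ℝ} (hα : |α| < 1) (r : ℝ) {a₁ : ℝ}
    (ha₁ : 0 < a₁) {N : ℕ} (hN : 0 < N) :
    ∃ (a : ℝ) (N' : ℕ), 0 < a ∧ ∀ (ζ q : ℕ → Vec3) (f : ℕ → ℝ) (a₂ : ℝ),
      PersistentlyExciting ζ a₁ a₂ N → (∀ k, ‖ζ k‖ ≤ r) → (∀ k, |f k| ≤ 1) →
      (∀ k, q (k + 1) = f k • q k - (2 : ℝ) • (ζ (k + 1) - α • ζ k)) →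
      ∀ k y, ∃ m < N', a * ‖y‖ ≤ |inner ℝ (q (k + m)) y| := by
  have hN' : (0 : ℝ) < N := by exact_mod_cast hN
  -- In each window some `|⟨ζ, y⟩|` is at least `b ‖y‖`. The threshold for `q` and the delay `R` are
  -- such that `|⟨ζ, y⟩|` would be at most `b / 2 * ‖y‖` from `R` steps after the start on.
  set b := Real.sqrt (a₁ / N) with hb
  have hb0 : 0 < b := Real.sqrt_pos.2 (by positivity)
  have hbsq : b ^ 2 * N = a₁ := by
    rw [hb, Real.sq_sqrt (by positivity)]
    field_simp
  have hr : 0 < |r| + 1 := by positivity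
  obtain ⟨R, hR⟩ := exists_pow_lt_of_lt_one (show 0 < b / 4 / (|r| + 1) by positivity) hα
  rw [lt_div_iff₀ hr] at hR
  refine ⟨b / 4 * (1 - |α|), R + N, by have := sub_pos.2 hα; positivity, ?_⟩
  intro ζ q f a₂ hPE hζ hf hq k y
  by_contra! hsmall
  have hy : 0 < ‖y‖ := by
    by_contra! h0
    have h1 := hsmall 0 (by omega)
    have h2 : ‖y‖ = 0 := le_antisymm h0 (norm_nonneg _)
    rw [h2, mul_zero] at h1
    exact absurd h1 (not_lt.2 (abs_nonneg _))
  have hdecay : ∀ m < R + N,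
      |inner ℝ (ζ (k + m)) y| ≤ (|α| ^ m * (|r| + 1) + b / 4) * ‖y‖ := by
    intro m
    induction m with
    | zero =>
      intro _
      have h1 := abs_real_inner_le_norm (ζ (k + 0)) y
      have h2 : ‖ζ (k + 0)‖ ≤ |r| + 1 + b / 4 := by
        linarith [hζ (k + 0), le_abs_self r]
      rw [pow_zero, one_mul]
      exact h1.trans (by gcongr)
    | succ m ih =>
      intro hm
      have h1 := ih (by omega)
      have h2 := hsmall m (by omega)
      have h3 := hsmall (m + 1) hm
      have h4 : inner ℝ (ζ (k + (m + 1))) y = α * inner ℝ (ζ (k + m)) y +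
          1 / 2 * (f (k + m) * inner ℝ (q (k + m)) y - inner ℝ (q (k + (m + 1))) y) := by
        rw [← add_assoc, hq (k + m)]
        simp only [inner_sub_left, real_inner_smul_left]
        ring
      have h5 : |f (k + m) * inner ℝ (q (k + m)) y| ≤ |inner ℝ (q (k + m)) y| := by
        rw [abs_mul]
        exact mul_le_of_le_one_left (abs_nonneg _) (hf _)
      have h6 : |inner ℝ (ζ (k + (m + 1))) y| ≤ |α| * |inner ℝ (ζ (k + m)) y| +
          1 / 2 * (|inner ℝ (q (k + m)) y| + |inner ℝ (q (k + (m + 1))) y|) := by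
        rw [h4]
        refine (abs_add_le _ _).trans ?_
        rw [abs_mul, abs_mul, abs_of_pos (by norm_num : (0 : ℝ) < 1 / 2)]
        have := abs_sub (f (k + m) * inner ℝ (q (k + m)) y) (inner ℝ (q (k + (m + 1))) y)
        linarith
      have h7 : |α| * |inner ℝ (ζ (k + m)) y| ≤
          |α| * ((|α| ^ m * (|r| + 1) + b / 4) * ‖y‖) := by gcongr
      rw [pow_succ]
      linarith
  have h1 := hPE.le_sum_inner_sq (k + R) y
  have h2 : ∑ m ∈ Finset.range N, inner ℝ (ζ (k + R + m)) y ^ 2 ≤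
      ∑ _m ∈ Finset.range N, (b / 2 * ‖y‖) ^ 2 := by
    refine Finset.sum_le_sum fun m hm => ?_
    rw [Finset.mem_range] at hm
    have h3 := hdecay (R + m) (by omega)
    have h4 : |α| ^ (R + m) * (|r| + 1) ≤ |α| ^ R * (|r| + 1) := by
      gcongr ?_ * _
      exact pow_le_pow_of_le_one (abs_nonneg _) hα.le (by omega)
    rw [← sq_abs, add_assoc]
    refine pow_le_pow_left₀ (abs_nonneg _) (h3.trans ?_) 2
    gcongr
    linarith
  rw [Finset.sum_const, Finset.card_range, nsmul_eq_mul] at h2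
  nlinarith [sq_nonneg ‖y‖, mul_pos ha₁ (pow_pos hy 2)]

/-- Uniform observability of the double integrator from the scalar outputs `⟨q, p⟩`. Along an
unforced trajectory `p` moves on a line; the outputs control `p` up to a multiple of the
speed at two times which are far apart, hence they control the speed as well. -/
lemma exists_norm_le_of_outputs_le {t : ℝ} (ht : 0 < t) (Q : ℝ) {a : ℝ} (ha : 0 < a) (N : ℕ) :
    ∃ (L : ℕ) (c : ℝ), 2 ≤ L ∧ 0 < c ∧ ∀ q, Excites q Q a N → ∀ (k : ℕ) (X d : ℕ → State) (δ : ℝ),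
      (∀ j < L, X (j + 1) = motionStep t (X j) 0 + d j) → (∀ j < L, ‖d j‖ ≤ δ) →
      (∀ j < L, |inner ℝ (q (k + j + 1)) (pos (X (j + 1)))| ≤ δ) →
      ‖X 0‖ ≤ c * δ ∧ ‖X L‖ ≤ c * δ := by
  -- The outputs determine a position up to `c₁` times the speed `w`, and `J` is so large that two
  -- positions `J` steps apart, at distance about `J t w`, cannot both be that small unless `w` is.
  set c₁ := |Q| * N * t / a with hc₁
  obtain ⟨J, hJ⟩ := exists_nat_ge ((2 * c₁ + 1) / t)
  rw [div_le_iff₀ ht] at hJ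
  set L := J + N + 2 with hL
  set E : ℝ := L * (1 + t * L) with hE
  set c₂ := (1 + |Q| * E) / a with hc₂
  set c₃ := 2 * c₂ + E with hc₃
  have hE0 : 0 ≤ E := by positivity
  have hc₁0 : 0 ≤ c₁ := by positivity
  have hc₂0 : 0 < c₂ := by positivity
  have hc₃0 : 0 < c₃ := by positivity
  refine ⟨L, (c₁ * c₃ + c₂ + t * c₃ + 1) + L * t * c₃ + E + c₃ + L, by omega,
    by positivity, ?_⟩
  intro q hq k X d δ hX hd ho
  have hδ : 0 ≤ δ := (norm_nonneg _).trans (hd 0 (by omega))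
  have hvel : ∀ j ≤ L, ‖vel (X j) - vel (X 0)‖ ≤ j * δ := by
    intro j
    induction j with
    | zero => simp
    | succ j ih =>
      intro hj
      have h1 := ih (by omega)
      have h2 : vel (X (j + 1)) - vel (X 0) = (vel (X j) - vel (X 0)) + vel (d j) := by
        rw [hX j (by omega), vel_add, vel_motionStep]
        simp
        abel
      rw [h2]
      have h3 := (norm_vel_le (d j)).trans (hd j (by omega))
      refine (norm_add_le _ _).trans ?_
      push_cast
      linarith
  have hpos : ∀ s m, s + m ≤ L →
      ‖pos (X (s + m)) - pos (X s) - (m * t) • vel (X 0)‖ ≤ E * δ := by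
    have key : ∀ s m, s + m ≤ L →
        ‖pos (X (s + m)) - pos (X s) - (m * t) • vel (X 0)‖ ≤ m * ((1 + t * L) * δ) := by
      intro s m
      induction m with
      | zero => simp
      | succ m ih =>
        intro hm
        have h1 := ih (by omega)
        have h2 : pos (X (s + (m + 1))) - pos (X s) - ((m + 1 : ℕ) * t) • vel (X 0) =
            (pos (X (s + m)) - pos (X s) - (m * t) • vel (X 0)) +
              t • (vel (X (s + m)) - vel (X 0)) + pos (d (s + m)) := by
          rw [← add_assoc, hX (s + m) (by omega), pos_add, pos_motionStep]
          push_cast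
          module
        rw [h2]
        have h3 := (norm_pos_le (d (s + m))).trans (hd (s + m) (by omega))
        have h4 := hvel (s + m) (by omega)
        have h5 : ‖t • (vel (X (s + m)) - vel (X 0))‖ ≤ t * (L * δ) := by
          rw [norm_smul, Real.norm_of_nonneg ht.le]
          refine mul_le_mul_of_nonneg_left (h4.trans ?_) ht.le
          gcongr
          omega
        refine (norm_add₃_le).trans ?_
        push_cast
        linarith
    intro s m hm
    refine (key s m hm).trans ?_
    rw [hE, mul_assoc]
    gcongr
    omega
  set w := ‖vel (X 0)‖ with hw
  have hw0 : 0 ≤ w := norm_nonneg _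
  have hstep : ∀ s, s + N ≤ L → ‖pos (X (s + 1))‖ ≤ c₁ * w + c₂ * δ := by
    intro s hs
    obtain ⟨m, hm, h1⟩ := hq.2 (k + (s + 1)) (pos (X (s + 1)))
    have h2 := ho (s + m) (by omega)
    have h3 := hpos (s + 1) m (by omega)
    rw [show k + (s + m) + 1 = k + (s + 1) + m by ring, show s + m + 1 = s + 1 + m by ring] at h2
    set q' := q (k + (s + 1) + m)
    have h4 : ‖pos (X (s + 1 + m)) - pos (X (s + 1))‖ ≤ N * t * w + E * δ := by
      have h5 := norm_add_le (pos (X (s + 1 + m)) - pos (X (s + 1)) - (m * t) • vel (X 0))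
        ((m * t) • vel (X 0))
      rw [sub_add_cancel, norm_smul, Real.norm_of_nonneg (by positivity)] at h5
      have h6 : (m : ℝ) * t * w ≤ N * t * w := by gcongr
      linarith
    have h5 : inner ℝ q' (pos (X (s + 1))) = inner ℝ q' (pos (X (s + 1 + m))) -
        inner ℝ q' (pos (X (s + 1 + m)) - pos (X (s + 1))) := by
      rw [inner_sub_right]
      ring
    have h6 : |inner ℝ q' (pos (X (s + 1 + m)) - pos (X (s + 1)))| ≤
        |Q| * (N * t * w + E * δ) := by
      refine (abs_real_inner_le_norm _ _).trans ?_
      gcongr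
      exact (hq.1 _).trans (le_abs_self Q)
    have h7 : a * ‖pos (X (s + 1))‖ ≤ δ + |Q| * (N * t * w + E * δ) := by
      refine h1.trans ?_
      rw [h5]
      exact (abs_sub _ _).trans (add_le_add h2 h6)
    have h8 : c₁ * w + c₂ * δ = (δ + |Q| * (N * t * w + E * δ)) / a := by
      rw [hc₁, hc₂]
      field_simp
      ring
    rw [h8, le_div_iff₀ ha]
    linarith
  have h1 := hstep 0 (by omega)
  have h2 := hstep J (by omega)
  have h3 := hpos 1 J (by omega)
  rw [zero_add] at h1
  rw [add_comm 1 J] at h3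
  have hspeed : w ≤ c₃ * δ := by
    have h4 : ‖((J : ℝ) * t) • vel (X 0)‖ ≤ ‖pos (X (J + 1))‖ + ‖pos (X 1)‖ + E * δ := by
      have h5 : ((J : ℝ) * t) • vel (X 0) = pos (X (J + 1)) - pos (X 1) -
          (pos (X (J + 1)) - pos (X 1) - ((J : ℝ) * t) • vel (X 0)) := by abel
      rw [h5]
      exact (norm_sub_le _ _).trans (add_le_add (norm_sub_le _ _) h3)
    rw [norm_smul, Real.norm_of_nonneg (by positivity)] at h4
    have h5 : (2 * c₁ + 1) * w ≤ J * t * w := by gcongr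
    rw [hc₃]
    linarith
  have hp1 : ‖pos (X 1)‖ ≤ (c₁ * c₃ + c₂) * δ := by
    have : c₁ * w ≤ c₁ * (c₃ * δ) := by gcongr
    linarith
  have hp0 : ‖pos (X 0)‖ ≤ (c₁ * c₃ + c₂ + t * c₃ + 1) * δ := by
    have h4 : pos (X 0) = pos (X 1) - t • vel (X 0) - pos (d 0) := by
      have := hX 0 (by omega)
      rw [zero_add] at this
      rw [this, pos_add, pos_motionStep]
      simp
      abel
    have h5 : ‖t • vel (X 0)‖ ≤ t * (c₃ * δ) := by
      rw [norm_smul, Real.norm_of_nonneg ht.le]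
      gcongr
    have h6 := (norm_pos_le (d 0)).trans (hd 0 (by omega))
    have h7 : ‖pos (X 0)‖ ≤ ‖pos (X 1)‖ + ‖t • vel (X 0)‖ + ‖pos (d 0)‖ := by
      rw [h4]
      exact (norm_sub_le _ _).trans (add_le_add_left (norm_sub_le _ _) _)
    linarith
  have hvL : ‖vel (X L)‖ ≤ (c₃ + L) * δ := by
    have h4 := hvel L le_rfl
    have h5 := norm_add_le (vel (X L) - vel (X 0)) (vel (X 0))
    rw [sub_add_cancel] at h5
    linarith
  have hpL : ‖pos (X L)‖ ≤ (c₁ * c₃ + c₂ + t * c₃ + 1 + L * t * c₃ + E) * δ := by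
    have h4 := hpos 0 L (by omega)
    rw [zero_add] at h4
    have h5 : pos (X L) = (pos (X L) - pos (X 0) - ((L : ℝ) * t) • vel (X 0)) +
        pos (X 0) + ((L : ℝ) * t) • vel (X 0) := by abel
    have h6 : ‖((L : ℝ) * t) • vel (X 0)‖ ≤ L * t * (c₃ * δ) := by
      rw [norm_smul, Real.norm_of_nonneg (by positivity)]
      gcongr
    have h7 : ‖pos (X L)‖ ≤ ‖pos (X L) - pos (X 0) - ((L : ℝ) * t) • vel (X 0)‖ + ‖pos (X 0)‖ +
        ‖((L : ℝ) * t) • vel (X 0)‖ := by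
      conv_lhs => rw [h5]
      exact norm_add₃_le
    linarith
  constructor
  · refine (norm_le_pos_add_vel _).trans ?_
    have : 0 ≤ (L * t * c₃ + E + L) * δ := by positivity
    linarith
  · refine (norm_le_pos_add_vel _).trans ?_
    linarith

lemma exists_norm_sq_le_sum_outputs {t : ℝ} (ht : 0 < t) (Q : ℝ) {a : ℝ} (ha : 0 < a) (N : ℕ) :
    ∃ (L : ℕ) (c : ℝ), 2 ≤ L ∧ 0 < c ∧ ∀ q, Excites q Q a N → ∀ (k : ℕ) (X d : ℕ → State),
      (∀ j < L, X (j + 1) = motionStep t (X j) 0 + d j) →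
      ‖X 0‖ ^ 2 ≤ c * ∑ j ∈ Finset.range L,
          (‖d j‖ ^ 2 + inner ℝ (q (k + j + 1)) (pos (X (j + 1))) ^ 2) ∧
        ‖X L‖ ^ 2 ≤ c * ∑ j ∈ Finset.range L,
          (‖d j‖ ^ 2 + inner ℝ (q (k + j + 1)) (pos (X (j + 1))) ^ 2) := by
  obtain ⟨L, c, hL, hc, h⟩ := exists_norm_le_of_outputs_le ht Q ha N
  refine ⟨L, c ^ 2, hL, by positivity, fun q hq k X d hX => ?_⟩
  set T := ∑ j ∈ Finset.range L,
    (‖d j‖ ^ 2 + inner ℝ (q (k + j + 1)) (pos (X (j + 1))) ^ 2) with hT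
  have hT0 : 0 ≤ T := Finset.sum_nonneg fun j _ => by positivity
  have hle : ∀ j < L, ‖d j‖ ^ 2 + inner ℝ (q (k + j + 1)) (pos (X (j + 1))) ^ 2 ≤ T := fun j hj =>
    Finset.single_le_sum
      (f := fun j => ‖d j‖ ^ 2 + inner ℝ (q (k + j + 1)) (pos (X (j + 1))) ^ 2)
      (fun j _ => by positivity) (Finset.mem_range.2 hj)
  obtain ⟨h0, h1⟩ := h q hq k X d (Real.sqrt T) hX
    (fun j hj => Real.le_sqrt_of_sq_le (by
      have := hle j hj
      have := sq_nonneg (inner ℝ (q (k + j + 1)) (pos (X (j + 1))))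
      linarith))
    (fun j hj => Real.abs_le_sqrt (by
      have := hle j hj
      have := sq_nonneg ‖d j‖
      linarith))
  have hs : (c * Real.sqrt T) ^ 2 = c ^ 2 * T := by rw [mul_pow, Real.sq_sqrt hT0]
  rw [← hs]
  exact ⟨pow_le_pow_left₀ (norm_nonneg _) h0 2, pow_le_pow_left₀ (norm_nonneg _) h1 2⟩

/-! ### Uniform bounds on the cost-to-arrive -/

lemma motionStep_eq_add (t : ℝ) (X : State) (u : Vec3) :
    motionStep t X u = motionStep t X 0 + motionStep t 0 u := by
  simp [motionStep]

lemma norm_motionStep_le {t : ℝ} (ht : 0 < t) (X : State) (u : Vec3) :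
    ‖motionStep t X u‖ ≤ (2 + t + t ^ 2) * (‖X‖ + ‖u‖) := by
  have h1 : ‖pos (motionStep t X u)‖ ≤ ‖X‖ + t * ‖X‖ + 1 / 2 * t ^ 2 * ‖u‖ := by
    rw [pos_motionStep]
    refine norm_add₃_le.trans ?_
    rw [norm_smul, norm_smul, Real.norm_of_nonneg ht.le,
      Real.norm_of_nonneg (by positivity : 0 ≤ 1 / 2 * t ^ 2)]
    have := norm_pos_le X
    have := mul_le_mul_of_nonneg_left (norm_vel_le X) ht.le
    linarith
  have h2 : ‖vel (motionStep t X u)‖ ≤ ‖X‖ + t * ‖u‖ := by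
    rw [vel_motionStep]
    refine (norm_add_le _ _).trans ?_
    rw [norm_smul, Real.norm_of_nonneg ht.le]
    have := norm_vel_le X
    linarith
  have h3 := norm_le_pos_add_vel (motionStep t X u)
  have h4 : 0 ≤ t ^ 2 * ‖X‖ := by positivity
  have h5 : 0 ≤ (2 + 1 / 2 * t ^ 2) * ‖u‖ := by positivity
  linarith

lemma norm_motionStep_sq_le {t : ℝ} (ht : 0 < t) (X : State) (u : Vec3) :
    ‖motionStep t X u‖ ^ 2 ≤ 2 * (2 + t + t ^ 2) ^ 2 * (‖X‖ ^ 2 + ‖u‖ ^ 2) := by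
  refine (pow_le_pow_left₀ (norm_nonneg _) (norm_motionStep_le ht X u) 2).trans ?_
  rw [mul_pow]
  have h : (‖X‖ + ‖u‖) ^ 2 ≤ 2 * (‖X‖ ^ 2 + ‖u‖ ^ 2) := add_sq_le
  have := mul_le_mul_of_nonneg_left h (sq_nonneg (2 + t + t ^ 2))
  linarith

lemma motionStep_motionStep_neg (t : ℝ) (X : State) :
    motionStep t (motionStep (-t) X 0) 0 = X := by
  apply state_ext <;> simp [pos_motionStep, vel_motionStep]

/-- The double integrator can be steered from rest at the origin to any state in two steps. -/
lemma motionStep_motionStep_zero {t : ℝ} (ht : t ≠ 0) (X : State) :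
    motionStep t (motionStep t 0 ((1 / t ^ 2) • pos X - (1 / (2 * t)) • vel X))
      ((3 / (2 * t)) • vel X - (1 / t ^ 2) • pos X) = X := by
  have h0 : pos 0 = 0 := rfl
  have h1 : vel 0 = 0 := rfl
  apply state_ext
  · simp only [pos_motionStep, vel_motionStep, h0, h1]
    ext i
    simp
    field_simp
    ring
  · simp only [vel_motionStep, h1]
    ext i
    simp
    field_simp
    ring

namespace Setup

variable (S : Setup)

lemma exists_predLyap_ge {c : ℝ} (hc : 0 < c) : ∃ c', 0 < c' ∧ ∀ q k,
    (∀ X, c * ‖X‖ ^ 2 ≤ S.lyap q k X) → ∀ X, c' * ‖X‖ ^ 2 ≤ S.predLyap q k X := by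
  obtain ⟨w, hw, hcost⟩ := exists_le_quadForm S.accVar_posDef.inv
  have ht := S.t_pos
  set D := 2 * (2 + S.t + S.t ^ 2) ^ 2 with hD
  have hD0 : 0 < D := by positivity
  have hm : 0 < min c w := lt_min hc hw
  refine ⟨min c w / D, by positivity, fun q k h X => ?_⟩
  obtain ⟨e, u, rfl, h1⟩ := S.exists_predLyap_eq q k X
  rw [h1]
  have h2 := norm_motionStep_sq_le ht e u
  have h3 : min c w / D * ‖motionStep S.t e u‖ ^ 2 ≤
      min c w / D * (D * (‖e‖ ^ 2 + ‖u‖ ^ 2)) := by gcongr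
  have h4 : min c w / D * (D * (‖e‖ ^ 2 + ‖u‖ ^ 2)) =
      min c w * ‖e‖ ^ 2 + min c w * ‖u‖ ^ 2 := by field_simp
  have h5 : min c w * ‖e‖ ^ 2 ≤ c * ‖e‖ ^ 2 := by gcongr; exact min_le_left _ _
  have h6 : min c w * ‖u‖ ^ 2 ≤ w * ‖u‖ ^ 2 := by gcongr; exact min_le_right _ _
  have h7 := h e
  have h8 : w * ‖u‖ ^ 2 ≤ S.inputCost u := hcost u
  linarith

lemma predLyap_le_lyap_succ (q : ℕ → Vec3) (k : ℕ) (X : State) :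
    S.predLyap q k X ≤ S.lyap q (k + 1) X := by
  rw [lyap_succ]
  have := S.obsVar_pos
  have : 0 ≤ inner ℝ (q (k + 1)) (pos X) ^ 2 / S.obsVar := by positivity
  linarith

lemma exists_lyap_ge_of_lt (L : ℕ) :
    ∃ c, 0 < c ∧ ∀ q, ∀ k < L, ∀ X, c * ‖X‖ ^ 2 ≤ S.lyap q k X := by
  have key : ∀ k, ∃ c, 0 < c ∧ ∀ q X, c * ‖X‖ ^ 2 ≤ S.lyap q k X := by
    intro k
    induction k with
    | zero =>
      obtain ⟨c, hc, h⟩ := exists_le_quadForm S.G₀_posDef.inv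
      exact ⟨c, hc, fun _ X => h X⟩
    | succ k ih =>
      obtain ⟨c, hc, h⟩ := ih
      obtain ⟨c', hc', h'⟩ := S.exists_predLyap_ge hc
      exact ⟨c', hc', fun q X => (h' q k (h q) X).trans (S.predLyap_le_lyap_succ q k X)⟩
  induction L with
  | zero => exact ⟨1, one_pos, fun _ k hk => absurd hk (Nat.not_lt_zero k)⟩
  | succ L ih =>
    obtain ⟨c, hc, h⟩ := ih
    obtain ⟨c', hc', h'⟩ := key L
    refine ⟨min c c', lt_min hc hc', fun q k hk X => ?_⟩
    rcases Nat.lt_succ_iff_lt_or_eq.1 hk with hk | rfl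
    · refine le_trans ?_ (h q k hk X)
      gcongr
      exact min_le_left _ _
    · refine le_trans ?_ (h' q X)
      gcongr
      exact min_le_right _ _

/-- Every state is the end of a trajectory whose inputs and outputs have at most the energy that
the cost-to-arrive assigns to the state. -/
lemma exists_trajectory_cost_le (q : ℕ → Vec3) (k L : ℕ) (X : State) :
    ∃ (x : ℕ → State) (u : ℕ → Vec3), x L = X ∧
      (∀ j < L, x (j + 1) = motionStep S.t (x j) (u j)) ∧
      ∑ j ∈ Finset.range L,
        (S.inputCost (u j) + inner ℝ (q (k + j + 1)) (pos (x (j + 1))) ^ 2 / S.obsVar) ≤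
      S.lyap q (k + L) X := by
  induction L generalizing X with
  | zero => exact ⟨fun _ => X, fun _ => 0, rfl, by simp, by simpa using S.lyap_nonneg q k X⟩
  | succ L ih =>
    obtain ⟨e, v, hX, hev⟩ := S.exists_predLyap_eq q (k + L) X
    obtain ⟨x, u, hx, hstep, hcost⟩ := ih e
    refine ⟨fun j => if j ≤ L then x j else X, fun j => if j < L then u j else v, by simp, ?_, ?_⟩
    · intro j hj
      rcases Nat.lt_succ_iff_lt_or_eq.1 hj with hj | rfl
      · have h1 : j + 1 ≤ L := hj
        have h2 : j ≤ L := hj.le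
        simp only [h1, h2, hj, if_true]
        exact hstep j hj
      · simp [hx, hX]
    · have h0 : S.lyap q (k + (L + 1)) X = S.lyap q (k + L) e + S.inputCost v +
          inner ℝ (q (k + L + 1)) (pos X) ^ 2 / S.obsVar := by
        rw [← add_assoc, lyap_succ, hev]
      rw [Finset.sum_range_succ, h0]
      have h1 : ∑ j ∈ Finset.range L,
          (S.inputCost (if j < L then u j else v) + inner ℝ (q (k + j + 1))
            (pos (if j + 1 ≤ L then x (j + 1) else X)) ^ 2 / S.obsVar) =
          ∑ j ∈ Finset.range L,
            (S.inputCost (u j) + inner ℝ (q (k + j + 1)) (pos (x (j + 1))) ^ 2 / S.obsVar) := by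
        refine Finset.sum_congr rfl fun j hj => ?_
        rw [Finset.mem_range] at hj
        rw [if_pos hj, if_pos (show j + 1 ≤ L from hj)]
      simp only [h1]
      simp
      linarith

/-- Uniform observability bounds the variance of the filter from above. -/
lemma exists_lyap_ge (Q : ℝ) {a : ℝ} (ha : 0 < a) (N : ℕ) :
    ∃ c, 0 < c ∧ ∀ q, Excites q Q a N → ∀ k X, c * ‖X‖ ^ 2 ≤ S.lyap q k X := by
  have ht := S.t_pos
  have hΓ := S.obsVar_pos
  obtain ⟨L, co, -, hco, hobs⟩ := exists_norm_sq_le_sum_outputs ht Q ha N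
  obtain ⟨c, hc, hlt⟩ := S.exists_lyap_ge_of_lt L
  obtain ⟨w, hw, hcost⟩ := exists_le_quadForm S.accVar_posDef.inv
  set D := 2 * (2 + S.t + S.t ^ 2) ^ 2 with hD
  have hD0 : 0 < D := by positivity
  set R := D / w + S.obsVar with hR
  have hR0 : 0 < R := by positivity
  refine ⟨min c (1 / (co * R)), lt_min hc (by positivity), fun q hq k X => ?_⟩
  rcases lt_or_ge k L with hk | hk
  · refine le_trans ?_ (hlt q k hk X)
    gcongr
    exact min_le_left _ _
  obtain ⟨k, rfl⟩ := Nat.exists_eq_add_of_le' hk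
  obtain ⟨x, u, rfl, hstep, hle⟩ := S.exists_trajectory_cost_le q k L X
  have h1 := (hobs q hq k x (fun j => motionStep S.t 0 (u j))
    (fun j hj => (hstep j hj).trans (motionStep_eq_add _ _ _))).2
  have h2 : ∑ j ∈ Finset.range L,
      (‖motionStep S.t 0 (u j)‖ ^ 2 + inner ℝ (q (k + j + 1)) (pos (x (j + 1))) ^ 2) ≤
      R * S.lyap q (k + L) (x L) := by
    refine le_trans ?_ (mul_le_mul_of_nonneg_left hle hR0.le)
    rw [Finset.mul_sum]
    refine Finset.sum_le_sum fun j _ => ?_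
    have h3 := norm_motionStep_sq_le ht 0 (u j)
    rw [norm_zero, zero_pow two_ne_zero, zero_add] at h3
    have h4 : w * ‖u j‖ ^ 2 ≤ S.inputCost (u j) := hcost (u j)
    have h5 : D * ‖u j‖ ^ 2 ≤ D / w * S.inputCost (u j) := by
      have : D / w * (w * ‖u j‖ ^ 2) = D * ‖u j‖ ^ 2 := by field_simp
      rw [← this]
      gcongr
    set o := inner ℝ (q (k + j + 1)) (pos (x (j + 1))) ^ 2 with ho
    have ho0 : 0 ≤ o := sq_nonneg _
    have h6 : o = S.obsVar * (o / S.obsVar) := by field_simp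
    have h7 : 0 ≤ D / w * (o / S.obsVar) := by positivity
    have h8 := mul_nonneg hΓ.le (S.inputCost_nonneg (u j))
    rw [hR]
    linarith
  have h3 : ‖x L‖ ^ 2 ≤ co * R * S.lyap q (k + L) (x L) := by
    rw [mul_assoc]
    exact h1.trans (by gcongr)
  calc min c (1 / (co * R)) * ‖x L‖ ^ 2 ≤ 1 / (co * R) * ‖x L‖ ^ 2 := by
        gcongr
        exact min_le_right _ _
    _ ≤ 1 / (co * R) * (co * R * S.lyap q (k + L) (x L)) := by gcongr
    _ = S.lyap q (k + L) (x L) := by field_simp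

/-- Controllability in two steps bounds the variance of the filter from below. -/
lemma exists_lyap_le (Q : ℝ) :
    ∃ C, 0 < C ∧ ∀ q : ℕ → Vec3, (∀ k, ‖q k‖ ≤ Q) → ∀ k X, S.lyap q k X ≤ C * ‖X‖ ^ 2 := by
  have ht := S.t_pos
  have hΓ := S.obsVar_pos
  obtain ⟨C₀, hC₀, h₀⟩ := exists_quadForm_le S.G₀⁻¹
  obtain ⟨w, hw, hcost⟩ := exists_quadForm_le S.accVar⁻¹
  have hcost : ∀ u, S.inputCost u ≤ w * ‖u‖ ^ 2 := hcost
  set D := 2 * (2 + S.t + S.t ^ 2) ^ 2 with hD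
  have hD0 : 0 < D := by positivity
  set κ := 1 / S.t ^ 2 + 3 / (2 * S.t) with hκ
  set Z := Q ^ 2 / S.obsVar with hZ
  have hZ0 : 0 ≤ Z := by positivity
  have hout : ∀ q : ℕ → Vec3, (∀ k, ‖q k‖ ≤ Q) → ∀ k X,
      inner ℝ (q k) (pos X) ^ 2 / S.obsVar ≤ Z * ‖X‖ ^ 2 := by
    intro q hq k X
    have h1 : |inner ℝ (q k) (pos X)| ≤ Q * ‖X‖ :=
      (abs_real_inner_le_norm _ _).trans
        (mul_le_mul (hq k) (norm_pos_le X) (norm_nonneg _) ((norm_nonneg _).trans (hq k)))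
    rw [hZ, div_mul_eq_mul_div, ← mul_pow, ← sq_abs]
    gcongr
  have hzero : ∀ q k, S.lyap q k 0 = 0 := fun q k => by simp [lyap]
  refine ⟨C₀ + (C₀ * D + Z) + (w * κ ^ 2 + Z * (D * κ ^ 2) + w * κ ^ 2 + Z), by positivity,
    fun q hq k X => ?_⟩
  have hX := sq_nonneg ‖X‖
  match k with
  | 0 =>
    have h1 : S.lyap q 0 X ≤ C₀ * ‖X‖ ^ 2 := h₀ X
    have : 0 ≤ ((C₀ * D + Z) + (w * κ ^ 2 + Z * (D * κ ^ 2) + w * κ ^ 2 + Z)) * ‖X‖ ^ 2 := by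
      positivity
    linarith
  | 1 =>
    have h1 := S.lyap_succ_motionStep_le q 0 (motionStep (-S.t) X 0) 0
    rw [motionStep_motionStep_neg] at h1
    have h2 : S.lyap q 0 (motionStep (-S.t) X 0) ≤ C₀ * ‖motionStep (-S.t) X 0‖ ^ 2 := h₀ _
    have h3 : S.inputCost 0 ≤ 0 := by simpa using hcost 0
    have h4 := hout q hq (0 + 1) X
    have h5 : ‖motionStep (-S.t) X 0‖ ^ 2 ≤ D * ‖X‖ ^ 2 := by
      have h6 : ‖motionStep (-S.t) X 0‖ ≤ (2 + S.t) * ‖X‖ := by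
        refine (norm_le_pos_add_vel _).trans ?_
        rw [pos_motionStep, vel_motionStep]
        simp only [smul_zero, add_zero, neg_smul]
        have h7 := norm_add_le (pos X) (-(S.t • vel X))
        rw [norm_neg, norm_smul, Real.norm_of_nonneg ht.le] at h7
        have := norm_pos_le X
        have := norm_vel_le X
        have := mul_le_mul_of_nonneg_left (norm_vel_le X) ht.le
        linarith
      refine (pow_le_pow_left₀ (norm_nonneg _) h6 2).trans ?_
      rw [mul_pow, hD]
      gcongr
      nlinarith [mul_pos ht ht, pow_pos ht 3, pow_pos ht 4]
    have h6 : C₀ * ‖motionStep (-S.t) X 0‖ ^ 2 ≤ C₀ * (D * ‖X‖ ^ 2) := by gcongr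
    have : 0 ≤ (C₀ + (w * κ ^ 2 + Z * (D * κ ^ 2) + w * κ ^ 2 + Z)) * ‖X‖ ^ 2 := by
      positivity
    simp only [zero_add] at h1 h4
    linarith
  | k + 2 =>
    set u₀ := (1 / S.t ^ 2) • pos X - (1 / (2 * S.t)) • vel X with hu₀
    set u₁ := (3 / (2 * S.t)) • vel X - (1 / S.t ^ 2) • pos X with hu₁
    have h1 := S.lyap_succ_motionStep_le q k 0 u₀
    have h2 := S.lyap_succ_motionStep_le q (k + 1) (motionStep S.t 0 u₀) u₁
    rw [motionStep_motionStep_zero ht.ne'] at h2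
    rw [hzero] at h1
    have hp := norm_pos_le X
    have hv := norm_vel_le X
    have hu₀n : ‖u₀‖ ≤ κ * ‖X‖ := by
      refine (norm_sub_le _ _).trans ?_
      rw [norm_smul, norm_smul, Real.norm_of_nonneg (by positivity),
        Real.norm_of_nonneg (by positivity), hκ, add_mul]
      gcongr
      norm_num
    have hu₁n : ‖u₁‖ ≤ κ * ‖X‖ := by
      refine (norm_sub_le _ _).trans ?_
      rw [norm_smul, norm_smul, Real.norm_of_nonneg (by positivity),
        Real.norm_of_nonneg (by positivity), hκ, add_mul, add_comm]
      gcongr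
    have hu₀s : ‖u₀‖ ^ 2 ≤ κ ^ 2 * ‖X‖ ^ 2 := by
      rw [← mul_pow]; gcongr
    have hu₁s : ‖u₁‖ ^ 2 ≤ κ ^ 2 * ‖X‖ ^ 2 := by
      rw [← mul_pow]; gcongr
    have h3 := norm_motionStep_sq_le ht 0 u₀
    rw [norm_zero, zero_pow two_ne_zero, zero_add] at h3
    have h4 := hout q hq (k + 1) (motionStep S.t 0 u₀)
    have h5 := hout q hq (k + 1 + 1) X
    have h6 : Z * ‖motionStep S.t 0 u₀‖ ^ 2 ≤ Z * (D * (κ ^ 2 * ‖X‖ ^ 2)) := by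
      gcongr
      exact h3.trans (by gcongr)
    have h7 : S.inputCost u₀ ≤ w * (κ ^ 2 * ‖X‖ ^ 2) := (hcost u₀).trans (by gcongr)
    have h8 : S.inputCost u₁ ≤ w * (κ ^ 2 * ‖X‖ ^ 2) := (hcost u₁).trans (by gcongr)
    have : 0 ≤ (C₀ + (C₀ * D + Z)) * ‖X‖ ^ 2 := by positivity
    show S.lyap q (k + 1 + 1) X ≤ _
    linarith

/-! ### Contraction of the error -/

/-- Along the error dynamics the cost-to-arrive grows in one step at most by the energy of
the disturbances, and over a window of fixed length it contracts up to that energy: the observations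
determine the error, so that small innovations are possible only for a small error. -/
lemma exists_contraction (Q : ℝ) {a : ℝ} (ha : 0 < a) (N : ℕ) :
    ∃ (L : ℕ) (g G c C : ℝ), 2 ≤ L ∧ 0 < g ∧ 0 < G ∧ 0 < c ∧ c ≤ 1 ∧ 0 < C ∧
      ∀ q, Excites q Q a N →
        (∀ k X, g * ‖X‖ ^ 2 ≤ S.lyap q k X ∧ S.lyap q k X ≤ G * ‖X‖ ^ 2) ∧
        ∀ (e : ℕ → State) (u : ℕ → Vec3) (ν : ℕ → ℝ),
          (∀ k, e (k + 1) = motionStep S.t (e k) (u k) +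
            (ν k - inner ℝ (q (k + 1)) (pos (motionStep S.t (e k) (u k)))) • S.gainVec q k) →
          (∀ k, S.lyap q (k + 1) (e (k + 1)) ≤
            S.lyap q k (e k) + C * (‖u k‖ ^ 2 + ν k ^ 2)) ∧
          ∀ k, S.lyap q (k + L) (e (k + L)) ≤ (1 - c) * S.lyap q k (e k) +
            ∑ j ∈ Finset.range L, C * (‖u (k + j)‖ ^ 2 + ν (k + j) ^ 2) := by
  have ht := S.t_pos
  have hΓ := S.obsVar_pos
  obtain ⟨L, co, hL, hco, hobs⟩ := exists_norm_sq_le_sum_outputs ht Q ha N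
  obtain ⟨g, hg, hge⟩ := S.exists_lyap_ge Q ha N
  obtain ⟨G, hG, hle⟩ := S.exists_lyap_le Q
  obtain ⟨cp, hcp, hpred⟩ := S.exists_predLyap_ge hg
  obtain ⟨w, hw, hcost⟩ := exists_quadForm_le S.accVar⁻¹
  have hcost : ∀ u, S.inputCost u ≤ w * ‖u‖ ^ 2 := hcost
  set D := 2 * (2 + S.t + S.t ^ 2) ^ 2 with hD
  have hD0 : 0 < D := by positivity
  -- `κ` bounds the gain and `s` the variance of the innovation
  set κ := Q / cp / S.obsVar with hκ
  set s := Q ^ 2 / cp + S.obsVar with hs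
  have hs0 : 0 < s := by positivity
  set R := 2 * D + 2 * κ ^ 2 + 2 with hR
  have hR0 : 0 < R := by positivity
  set C := w + 1 / S.obsVar + 1 / s with hC
  have hC0 : 0 < C := by positivity
  refine ⟨L, g, G, min 1 (1 / (s * (G * (co * R)))), C, hL, hg, hG,
    lt_min one_pos (by positivity), min_le_left _ _, hC0, fun q hq =>
    ⟨fun k X => ⟨hge q hq k X, hle q hq.1 k X⟩, fun e u ν hstep => ?_⟩⟩
  set ι : ℕ → ℝ := fun k =>
    ν k - inner ℝ (q (k + 1)) (pos (motionStep S.t (e k) (u k))) with hι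
  have hgain : ∀ k, ‖S.gainVec q k‖ ≤ κ := fun k =>
    S.norm_gainVec_le hcp (hq.1 _) (hpred q k (hge q hq k))
  have hinnov : ∀ k, S.innovVar q k ≤ s := fun k =>
    (S.norm_predVar_obsRow_le hcp (hq.1 _) (hpred q k (hge q hq k))).2
  have hone : ∀ k, S.lyap q (k + 1) (e (k + 1)) ≤ S.lyap q k (e k) +
      (w * ‖u k‖ ^ 2 + ν k ^ 2 / S.obsVar - ι k ^ 2 / s) := by
    intro k
    have h1 := S.lyap_succ_correct_le q k (e k) (u k) (ν k)
    rw [← hstep k] at h1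
    have h2 : ι k ^ 2 / s ≤ ι k ^ 2 / S.innovVar q k := by
      have := S.innovVar_pos q k
      gcongr
      exact hinnov k
    have h3 := hcost (u k)
    simp only [hι] at h2 ⊢
    linarith
  have hmany : ∀ k m, S.lyap q (k + m) (e (k + m)) ≤ S.lyap q k (e k) +
      ∑ j ∈ Finset.range m,
        (w * ‖u (k + j)‖ ^ 2 + ν (k + j) ^ 2 / S.obsVar - ι (k + j) ^ 2 / s) := by
    intro k m
    induction m with
    | zero => simp
    | succ m ih =>
      rw [Finset.sum_range_succ, ← add_assoc]
      have := hone (k + m)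
      linarith
  refine ⟨fun k => (hone k).trans ?_, fun k => ?_⟩
  · have h1 : 0 ≤ ι k ^ 2 / s := by positivity
    have h2 : 0 ≤ (1 / S.obsVar + 1 / s) * ‖u k‖ ^ 2 := by positivity
    have h3 : 0 ≤ (w + 1 / s) * ν k ^ 2 := by positivity
    have h4 : ν k ^ 2 / S.obsVar = 1 / S.obsVar * ν k ^ 2 := by ring
    rw [hC]
    linarith
  have houtput : ∀ k, inner ℝ (q (k + 1)) (pos (e (k + 1))) ^ 2 ≤ 2 * (ν k ^ 2 + ι k ^ 2) := by
    intro k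
    have h1 : inner ℝ (q (k + 1)) (pos (e (k + 1))) =
        ν k + -(ι k * (S.obsVar / S.innovVar q k)) := by
      rw [hstep k, pos_add, pos_smul, inner_add_right, real_inner_smul_right, inner_gainVec]
      simp only [hι]
      ring
    have h2 : S.obsVar / S.innovVar q k ≤ 1 :=
      (div_le_one (S.innovVar_pos q k)).2 (S.obsVar_le_innovVar q k)
    have h3 : 0 ≤ S.obsVar / S.innovVar q k := div_nonneg hΓ.le (S.innovVar_pos q k).le
    rw [h1]
    refine add_sq_le.trans ?_
    have h4 : (-(ι k * (S.obsVar / S.innovVar q k))) ^ 2 ≤ ι k ^ 2 := by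
      rw [neg_sq, mul_pow]
      exact mul_le_of_le_one_right (sq_nonneg _) (pow_le_one₀ h3 h2)
    linarith
  have hdist : ∀ k, ‖motionStep S.t 0 (u k) + ι k • S.gainVec q k‖ ^ 2 ≤
      2 * (D * ‖u k‖ ^ 2 + κ ^ 2 * ι k ^ 2) := by
    intro k
    have h1 := norm_motionStep_sq_le ht 0 (u k)
    rw [norm_zero, zero_pow two_ne_zero, zero_add] at h1
    have h2 : ‖ι k • S.gainVec q k‖ ^ 2 ≤ κ ^ 2 * ι k ^ 2 := by
      rw [norm_smul, mul_pow, mul_comm, Real.norm_eq_abs, sq_abs]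
      gcongr
      exact hgain k
    have h3 := pow_le_pow_left₀ (norm_nonneg _)
      (norm_add_le (motionStep S.t 0 (u k)) (ι k • S.gainVec q k)) 2
    refine h3.trans (add_sq_le.trans ?_)
    linarith
  set T := ∑ j ∈ Finset.range L, (‖u (k + j)‖ ^ 2 + ν (k + j) ^ 2) with hT
  set I := ∑ j ∈ Finset.range L, ι (k + j) ^ 2 with hI
  have hobs' : ‖e k‖ ^ 2 ≤ co * (R * (T + I)) := by
    have h1 := (hobs q hq k (fun j => e (k + j))
      (fun j => motionStep S.t 0 (u (k + j)) + ι (k + j) • S.gainVec q (k + j)) (fun j _ => by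
        refine (hstep (k + j)).trans ?_
        show motionStep S.t (e (k + j)) (u (k + j)) + ι (k + j) • _ = _
        rw [motionStep_eq_add, add_assoc])).1
    refine h1.trans (mul_le_mul_of_nonneg_left ?_ hco.le)
    rw [hT, hI, ← Finset.sum_add_distrib, Finset.mul_sum]
    refine Finset.sum_le_sum fun j _ => ?_
    have h2 := hdist (k + j)
    have h3 := houtput (k + j)
    have h4 : 0 ≤ (2 * κ ^ 2 + 2) * ‖u (k + j)‖ ^ 2 := by positivity
    have h5 : 0 ≤ (2 * D + 2 * κ ^ 2) * ν (k + j) ^ 2 := by positivity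
    have h6 : 0 ≤ 2 * D * ι (k + j) ^ 2 := by positivity
    rw [hR]
    show _ + inner ℝ (q (k + j + 1)) (pos (e (k + j + 1))) ^ 2 ≤ _
    linarith
  have hV : S.lyap q k (e k) ≤ G * (co * R) * (T + I) := by
    refine (hle q hq.1 k (e k)).trans ?_
    have := mul_le_mul_of_nonneg_left hobs' hG.le
    linarith
  have hV' : 1 / (s * (G * (co * R))) * S.lyap q k (e k) ≤ (T + I) / s := by
    calc 1 / (s * (G * (co * R))) * S.lyap q k (e k) ≤
        1 / (s * (G * (co * R))) * (G * (co * R) * (T + I)) := by gcongr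
      _ = (T + I) / s := by field_simp
  have hmin : min 1 (1 / (s * (G * (co * R)))) * S.lyap q k (e k) ≤ (T + I) / s :=
    (mul_le_mul_of_nonneg_right (min_le_right _ _) (S.lyap_nonneg q k _)).trans hV'
  have hsum : ∑ j ∈ Finset.range L,
      (w * ‖u (k + j)‖ ^ 2 + ν (k + j) ^ 2 / S.obsVar - ι (k + j) ^ 2 / s) ≤
      (w + 1 / S.obsVar) * T - I / s := by
    rw [hT, hI, Finset.mul_sum, Finset.sum_div, ← Finset.sum_sub_distrib]
    refine Finset.sum_le_sum fun j _ => ?_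
    have h2 : 0 ≤ (1 / S.obsVar) * ‖u (k + j)‖ ^ 2 := by positivity
    have h3 : 0 ≤ w * ν (k + j) ^ 2 := by positivity
    have h4 : ν (k + j) ^ 2 / S.obsVar = 1 / S.obsVar * ν (k + j) ^ 2 := by ring
    linarith
  have h1 := hmany k L
  rw [← Finset.mul_sum, ← hT, hC]
  have h2 : (T + I) / s = 1 / s * T + I / s := by ring
  linarith

end Setup

/-! ### The relative position of the guardians -/

lemma limiter_mem_Icc {β U : ℝ} (hβ : 1 < β) (hU : 0 < U) (d₁ d₂ : ℝ) :
    limiter β U d₁ d₂ ∈ Set.Icc (1 / β) 1 := by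
  have hβ0 : 0 < β := one_pos.trans hβ
  have hm : U ≤ max U ((d₁ + d₂) / 2) := le_max_left _ _
  have hm0 := hU.trans_le hm
  have h1 : 0 ≤ U * (β - 1) / max U ((d₁ + d₂) / 2) :=
    div_nonneg (mul_nonneg hU.le (by linarith)) hm0.le
  have h2 : U * (β - 1) / max U ((d₁ + d₂) / 2) ≤ β - 1 := by
    rw [div_le_iff₀ hm0, mul_comm]
    exact mul_le_mul_of_nonneg_left hm (by linarith)
  unfold limiter
  constructor
  · exact le_mul_of_one_le_right (by positivity) (by linarith)
  · rw [one_div, inv_mul_le_iff₀ hβ0]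
    linarith

namespace Setup

variable (S : Setup)

/-- A bound on the factor `1 + (α - 1) g` by which the relative position is multiplied. -/
def relFactor : ℝ := max (-S.α) (1 - (1 - S.α) / S.β)

lemma abs_α_lt_one : |S.α| < 1 := by
  have h1 := S.α_mem.1
  have h2 := inv_lt_one_of_one_lt₀ S.one_lt_β
  rw [abs_of_neg S.α_mem.2]
  linarith

lemma relFactor_lt_one : S.relFactor < 1 := by
  have h1 := S.abs_α_lt_one
  rw [abs_of_neg S.α_mem.2] at h1
  have h2 : 0 < (1 - S.α) / S.β :=
    div_pos (by linarith [S.α_mem.2]) (one_pos.trans S.one_lt_β)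
  exact max_lt h1 (by linarith)

/-- The velocities and the tracked target cancel in the relative position of the guardians. -/
lemma pos_trackingControl_sub (ζ : ℕ → Vec3) (X : Fin 2 → State) (T : State) (k : ℕ) :
    pos (motionStep S.t (X 0) (S.trackingControl ζ X T k 0)) -
        pos (motionStep S.t (X 1) (S.trackingControl ζ X T k 1)) =
      (1 + (S.α - 1) * limiter S.β S.U ‖pos (X 0) - pos T‖ ‖pos (X 1) - pos T‖) •
          (pos (X 0) - pos (X 1)) - (2 : ℝ) • (ζ (k + 1) - S.α • ζ k) := by
  have ht := S.t_pos.ne'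
  simp only [pos_motionStep, trackingControl]
  ext i
  simp
  field_simp
  ring

lemma pos_control_sub (ζ : ℕ → Vec3) (X : Fin 2 → State) (X₁ Xhat : State) (k : ℕ) :
    ∃ f, |f| ≤ S.relFactor ∧
      pos (motionStep S.t (X 0) (S.control ζ X X₁ Xhat k 0)) -
          pos (motionStep S.t (X 1) (S.control ζ X X₁ Xhat k 1)) =
        f • (pos (X 0) - pos (X 1)) - (2 : ℝ) • (ζ (k + 1) - S.α • ζ k) := by
  have key : ∀ d₁ d₂, |1 + (S.α - 1) * limiter S.β S.U d₁ d₂| ≤ S.relFactor := by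
    intro d₁ d₂
    obtain ⟨h1, h2⟩ := limiter_mem_Icc S.one_lt_β S.U_pos d₁ d₂
    have h3 := S.α_mem.2
    have h4 : (1 - S.α) * (1 / S.β) ≤ (1 - S.α) * limiter S.β S.U d₁ d₂ :=
      mul_le_mul_of_nonneg_left h1 (by linarith)
    have h5 : (1 - S.α) * limiter S.β S.U d₁ d₂ ≤ (1 - S.α) * 1 :=
      mul_le_mul_of_nonneg_left h2 (by linarith)
    have h6 : (1 - S.α) * (1 / S.β) = (1 - S.α) / S.β := by ring
    have h7 : -S.α ≤ S.relFactor := le_max_left _ _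
    have h8 : 1 - (1 - S.α) / S.β ≤ S.relFactor := le_max_right _ _
    rw [abs_le]
    constructor <;> linarith
  unfold control
  split_ifs
  · exact ⟨_, key _ _, S.pos_trackingControl_sub ζ X X₁ k⟩
  · exact ⟨_, key _ _, S.pos_trackingControl_sub ζ X Xhat k⟩

end Setup

lemma norm_le_of_recursion {α φ r Q : ℝ} (hα : |α| ≤ 1) (hφ : φ < 1)
    {ζ q : ℕ → Vec3} {f : ℕ → ℝ} (hζ : ∀ k, ‖ζ k‖ ≤ r) (hf : ∀ k, |f k| ≤ φ)
    (hq : ∀ k, q (k + 1) = f k • q k - (2 : ℝ) • (ζ (k + 1) - α • ζ k))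
    (hQ₀ : ‖q 0‖ ≤ Q) (hQ : 4 * r / (1 - φ) ≤ Q) (k : ℕ) : ‖q k‖ ≤ Q := by
  rw [div_le_iff₀ (sub_pos.2 hφ)] at hQ
  induction k with
  | zero => exact hQ₀
  | succ k ih =>
    rw [hq k]
    have h1 : ‖f k • q k‖ ≤ φ * Q := by
      rw [norm_smul, Real.norm_eq_abs]
      exact mul_le_mul (hf k) ih (norm_nonneg _) ((abs_nonneg _).trans (hf k))
    have h2 : ‖ζ (k + 1) - α • ζ k‖ ≤ r + 1 * r := by
      refine (norm_sub_le _ _).trans (add_le_add (hζ _) ?_)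
      rw [norm_smul, Real.norm_eq_abs]
      exact mul_le_mul hα (hζ k) (norm_nonneg _) zero_le_one
    have h3 := norm_sub_le (f k • q k) ((2 : ℝ) • (ζ (k + 1) - α • ζ k))
    rw [norm_smul (2 : ℝ), Real.norm_of_nonneg (by norm_num : (0 : ℝ) ≤ 2)] at h3
    linarith

namespace ClosedLoop

variable {S : Setup} {Ω : Type*} [MeasurableSpace Ω] {P : Measure Ω} (L : ClosedLoop S P)

lemma exists_relPos_recursion (ω : Ω) :
    ∃ f : ℕ → ℝ, (∀ k, |f k| ≤ S.relFactor) ∧ ∀ k, L.relPos (k + 1) ω = f k • L.relPos k ω -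
      (2 : ℝ) • (shapeVec S.ρ S.h (fun m => L.radius m ω) (k + 1) -
        S.α • shapeVec S.ρ S.h (fun m => L.radius m ω) k) := by
  have h : ∀ k, ∃ f, |f| ≤ S.relFactor ∧ L.relPos (k + 1) ω = f • L.relPos k ω -
      (2 : ℝ) • (shapeVec S.ρ S.h (fun m => L.radius m ω) (k + 1) -
        S.α • shapeVec S.ρ S.h (fun m => L.radius m ω) k) := by
    intro k
    obtain ⟨f, hf, h⟩ := S.pos_control_sub (shapeVec S.ρ S.h fun m => L.radius m ω)
      (fun i => L.guardian i k ω) (L.target 0 k ω) (L.estimate k ω) k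
    refine ⟨f, hf, ?_⟩
    rw [relPos, L.guardian_succ, L.guardian_succ]
    exact h
  choose f hf using h
  exact ⟨f, fun k => (hf k).1, fun k => (hf k).2⟩

end ClosedLoop

/-- The relative position of the guardians is bounded and excites all directions, with constants
that depend on the design data only. -/
lemma Setup.exists_excites_relPos (S : Setup) :
    ∃ (Q a : ℝ) (N : ℕ), 0 < Q ∧ 0 < a ∧
      ∀ {Ω : Type*} [MeasurableSpace Ω] {P : Measure Ω} (L : ClosedLoop S P),
        ∀ᵐ ω ∂P, Excites (fun k => L.relPos k ω) Q a N := by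
  obtain ⟨a, N, ha, h⟩ := exists_le_abs_inner_of_persistentlyExciting S.abs_α_lt_one S.rBar
    S.aLow_pos S.N_pos
  have hφ := sub_pos.2 S.relFactor_lt_one
  set q₀ := ‖pos (S.guardian₀ 0) - pos (S.guardian₀ 1)‖ with hq₀
  refine ⟨q₀ + 4 * |S.rBar| / (1 - S.relFactor) + 1, a, N, by positivity, ha, ?_⟩
  intro Ω _ P L
  filter_upwards [L.shape_bounded, L.shape_pe] with ω hb hpe
  obtain ⟨f, hf, hrec⟩ := L.exists_relPos_recursion ω
  set ζ := shapeVec S.ρ S.h fun m => L.radius m ω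
  have h0 : 0 ≤ 4 * |S.rBar| / (1 - S.relFactor) := by positivity
  have h1 : ‖L.relPos 0 ω‖ = q₀ := by
    rw [ClosedLoop.relPos, L.guardian_zero, L.guardian_zero]
  have h2 : 0 ≤ q₀ := norm_nonneg _
  refine ⟨?_, h ζ (fun k => L.relPos k ω) f S.aHigh hpe hb
    (fun k => (hf k).trans S.relFactor_lt_one.le) hrec⟩
  exact norm_le_of_recursion (q := fun k => L.relPos k ω) S.abs_α_lt_one.le S.relFactor_lt_one
    (fun k => (hb k).trans (le_abs_self _)) hf hrec
    (by rw [h1]; linarith) (by linarith)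

/-! ### Second moments -/

namespace Setup

variable (S : Setup)

lemma integrable_norm_sq_accLaw : Integrable (fun x => ‖x‖ ^ 2) S.accLaw := by
  have h : ∀ W : Matrix (Fin 3) (Fin 3) ℝ,
      Integrable (fun x : Vec3 => ‖x‖ ^ 2) (multivariateGaussian 0 W) := fun W =>
    (IsGaussian.memLp_two_id (μ := multivariateGaussian 0 W)).integrable_norm_pow two_ne_zero
  exact ((h _).smul_measure ENNReal.ofReal_ne_top).add_measure
    ((h _).smul_measure ENNReal.ofReal_ne_top)

/-- A bound on the second moments of the disturbances of the error dynamics in one step.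
The second summand comes from `((η₁ - η₂) / 2)² ≤ (η₁² + η₂²) / 2`. -/
def disturbanceBound : ℝ :=
  ∫ x, ‖x‖ ^ 2 ∂S.accLaw +
    1 / 2 * (∫ x, x ^ 2 ∂gaussianReal 0 (S.σ 0) + ∫ x, x ^ 2 ∂gaussianReal 0 (S.σ 1))

lemma disturbanceBound_nonneg : 0 ≤ S.disturbanceBound := by
  have h1 : 0 ≤ ∫ x, ‖x‖ ^ 2 ∂S.accLaw := integral_nonneg fun x => sq_nonneg _
  have h2 : ∀ i, 0 ≤ ∫ x, x ^ 2 ∂gaussianReal 0 (S.σ i) := fun i =>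
    integral_nonneg fun x => sq_nonneg _
  have := h2 0
  have := h2 1
  unfold disturbanceBound
  positivity

end Setup

namespace ClosedLoop

variable {S : Setup} {Ω : Type*} [MeasurableSpace Ω] {P : Measure Ω} (L : ClosedLoop S P)

/-- The noise of the linear observation at time `k + 1`, with the sign for which
`Y = C X̄ - ν`. -/
def obsNoise (k : ℕ) (ω : Ω) : ℝ := 1 / 2 * (L.noise 0 (k + 1) ω - L.noise 1 (k + 1) ω)

/-- The energy of the disturbances that act on the error in the step from `k` to `k + 1`. -/
def disturbance (k : ℕ) (ω : Ω) : ℝ := ‖L.acc 1 k ω‖ ^ 2 + L.obsNoise k ω ^ 2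

lemma err_succ (k : ℕ) (ω : Ω) :
    L.err (k + 1) ω = motionStep S.t (L.err k ω) (L.acc 1 k ω) +
      (L.obsNoise k ω - inner ℝ (L.relPos (k + 1) ω)
        (pos (motionStep S.t (L.err k ω) (L.acc 1 k ω)))) •
        S.gainVec (fun m => L.relPos m ω) k := by
  have hx : motionStep S.t (L.err k ω) (L.acc 1 k ω) =
      L.target 1 (k + 1) ω - toEuclideanLin (sysA S.t) (L.estimate k ω) := by
    rw [L.target_succ, err]
    simp only [motionStep, map_sub]
    abel
  have hK : S.gainVec (fun m => L.relPos m ω) k = WithLp.toLp 2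
      (S.filterGain (fun m => pos (L.guardian 0 m ω) - pos (L.guardian 1 m ω)) k) := rfl
  rw [hx, err, L.estimate_succ, hK, obsRow_dotProduct, norm_sub_sq_real, norm_sub_sq_real,
    relPos, pos_sub, obsNoise, inner_sub_right, inner_sub_left, inner_sub_left]
  module

lemma integrable_acc_sq (k : ℕ) : Integrable (fun ω => ‖L.acc 1 k ω‖ ^ 2) P := by
  have h := S.integrable_norm_sq_accLaw
  rw [← (L.acc_law k).map_eq] at h
  exact h.comp_measurable (L.acc_meas 1 k)

lemma integral_acc_sq (k : ℕ) : ∫ ω, ‖L.acc 1 k ω‖ ^ 2 ∂P = ∫ x, ‖x‖ ^ 2 ∂S.accLaw :=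
  (L.acc_law k).integral_comp S.integrable_norm_sq_accLaw.aestronglyMeasurable

lemma integrable_noise_sq (i : Fin 2) (k : ℕ) : Integrable (fun ω => L.noise i k ω ^ 2) P := by
  have h := (memLp_id_gaussianReal' (μ := 0) (v := S.σ i) 2 (by simp)).integrable_sq
  rw [← (L.noise_law i k).map_eq] at h
  exact h.comp_measurable (L.noise_meas i k)

lemma integral_noise_sq (i : Fin 2) (k : ℕ) :
    ∫ ω, L.noise i k ω ^ 2 ∂P = ∫ x, x ^ 2 ∂gaussianReal 0 (S.σ i) :=
  (L.noise_law i k).integral_comp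
    (memLp_id_gaussianReal' (μ := 0) (v := S.σ i) 2 (by simp)).integrable_sq.aestronglyMeasurable

lemma obsNoise_sq_le (k : ℕ) (ω : Ω) :
    L.obsNoise k ω ^ 2 ≤ 1 / 2 * (L.noise 0 (k + 1) ω ^ 2 + L.noise 1 (k + 1) ω ^ 2) := by
  unfold obsNoise
  nlinarith [sq_nonneg (L.noise 0 (k + 1) ω + L.noise 1 (k + 1) ω)]

lemma measurable_obsNoise (k : ℕ) : Measurable (L.obsNoise k) :=
  ((L.noise_meas 0 (k + 1)).sub (L.noise_meas 1 (k + 1))).const_mul _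

lemma integrable_disturbance (k : ℕ) : Integrable (L.disturbance k) P := by
  refine (L.integrable_acc_sq k).add ?_
  refine Integrable.mono' (((L.integrable_noise_sq 0 (k + 1)).add
    (L.integrable_noise_sq 1 (k + 1))).const_mul (1 / 2))
    ((L.measurable_obsNoise k).pow_const 2).aestronglyMeasurable
    (Filter.Eventually.of_forall fun ω => ?_)
  rw [Real.norm_of_nonneg (sq_nonneg _)]
  exact L.obsNoise_sq_le k ω

lemma integral_disturbance_le (k : ℕ) : ∫ ω, L.disturbance k ω ∂P ≤ S.disturbanceBound := by
  have h0 := L.integrable_noise_sq 0 (k + 1)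
  have h1 := L.integrable_noise_sq 1 (k + 1)
  have h : ∫ ω, L.disturbance k ω ∂P ≤ ∫ ω, (‖L.acc 1 k ω‖ ^ 2 +
      1 / 2 * (L.noise 0 (k + 1) ω ^ 2 + L.noise 1 (k + 1) ω ^ 2)) ∂P :=
    integral_mono (L.integrable_disturbance k)
      ((L.integrable_acc_sq k).add ((h0.add h1).const_mul _))
      fun ω => by
        have := L.obsNoise_sq_le k ω
        simp only [disturbance]
        linarith
  have h2 : ∫ ω, (‖L.acc 1 k ω‖ ^ 2 +
      1 / 2 * (L.noise 0 (k + 1) ω ^ 2 + L.noise 1 (k + 1) ω ^ 2)) ∂P = S.disturbanceBound := by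
    have h3 := integral_add (L.integrable_acc_sq k) ((h0.add h1).const_mul (1 / 2))
    have h4 := integral_add h0 h1
    simp only [Pi.add_apply] at h3
    rw [h3, integral_const_mul, h4, integral_acc_sq, integral_noise_sq, integral_noise_sq]
    rfl
  exact h.trans_eq h2

lemma measurable_err (k : ℕ) : Measurable (L.err k) := (L.target_meas 1 k).sub (L.estimate_meas k)

end ClosedLoop

/-! ### The mean-square error -/

lemma le_geom_of_contraction {V n : ℕ → ℝ} {c : ℝ} (hc : c ≤ 1) {L : ℕ}
    (h : ∀ k, V (k + L) ≤ (1 - c) * V k + n k) (k ℓ : ℕ) :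
    V (k + ℓ * L) ≤ (1 - c) ^ ℓ * V k +
      ∑ i ∈ Finset.range ℓ, (1 - c) ^ i * n (k + (ℓ - 1 - i) * L) := by
  induction ℓ with
  | zero => simp
  | succ ℓ ih =>
    have h1 := h (k + ℓ * L)
    have h2 := mul_le_mul_of_nonneg_left ih (sub_nonneg.2 hc)
    rw [Finset.sum_range_succ', show k + (ℓ + 1) * L = k + ℓ * L + L by ring]
    have h3 : ∑ i ∈ Finset.range ℓ, (1 - c) ^ (i + 1) * n (k + (ℓ + 1 - 1 - (i + 1)) * L) =
        (1 - c) * ∑ i ∈ Finset.range ℓ, (1 - c) ^ i * n (k + (ℓ - 1 - i) * L) := by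
      rw [Finset.mul_sum]
      refine Finset.sum_congr rfl fun i _ => ?_
      rw [show ℓ + 1 - 1 - (i + 1) = ℓ - 1 - i by omega, pow_succ]
      ring
    rw [h3]
    simp only [pow_zero, one_mul, Nat.add_sub_cancel, Nat.sub_zero, pow_succ]
    linarith

lemma sum_pow_le_inv {c : ℝ} (hc : 0 < c) (hc1 : c ≤ 1) (m : ℕ) :
    ∑ i ∈ Finset.range m, (1 - c) ^ i ≤ 1 / c := by
  have h := mul_neg_geom_sum (1 - c) m
  have h1 : 0 ≤ (1 - c) ^ m := pow_nonneg (by linarith) _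
  rw [le_div_iff₀ hc]
  linarith

lemma smul_one_le_of_quadForm {H : StateMatrix} (hH : H.IsHermitian) {g : ℝ}
    (h : ∀ X : State, g * ‖X‖ ^ 2 ≤ X.ofLp ⬝ᵥ H *ᵥ X.ofLp) : g • (1 : StateMatrix) ≤ H := by
  rw [le_iff]
  refine PosSemidef.of_dotProduct_mulVec_nonneg
    (hH.sub (isHermitian_one.smul (IsSelfAdjoint.all g))) fun x => ?_
  have h1 := h (WithLp.toLp 2 x)
  rw [norm_sq_eq_dotProduct] at h1
  simp only [star_trivial, sub_mulVec, dotProduct_sub, smul_mulVec, one_mulVec, dotProduct_smul,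
    smul_eq_mul]
  linarith

lemma le_smul_one_of_quadForm {H : StateMatrix} (hH : H.IsHermitian) {G : ℝ}
    (h : ∀ X : State, X.ofLp ⬝ᵥ H *ᵥ X.ofLp ≤ G * ‖X‖ ^ 2) : H ≤ G • (1 : StateMatrix) := by
  rw [le_iff]
  refine PosSemidef.of_dotProduct_mulVec_nonneg
    ((isHermitian_one.smul (IsSelfAdjoint.all G)).sub hH) fun x => ?_
  have h1 := h (WithLp.toLp 2 x)
  rw [norm_sq_eq_dotProduct] at h1
  simp only [star_trivial, sub_mulVec, dotProduct_sub, smul_mulVec, one_mulVec, dotProduct_smul,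
    smul_eq_mul]
  linarith

namespace Setup

variable (S : Setup)

lemma cALow_pos : 0 < S.cALow := by
  have ht := S.t_pos
  have h : S.t * Real.sqrt (4 + S.t ^ 2) < 2 + S.t ^ 2 := by
    refine lt_of_pow_lt_pow_left₀ 2 (by positivity) ?_
    rw [mul_pow, Real.sq_sqrt (by positivity)]
    nlinarith
  unfold cALow
  linarith

lemma cWHigh_nonneg : 0 ≤ S.cWHigh := by
  have h : ∀ i, 0 ≤ S.wHigh i := by
    intro i
    have h1 := (le_iff.1 (S.W_bounds i).2).diag_nonneg (i := (0 : Fin 3))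
    have h2 := (le_iff.1 (S.W_bounds i).1).diag_nonneg (i := (0 : Fin 3))
    simp only [Matrix.sub_apply, Matrix.smul_apply, Matrix.one_apply_eq, smul_eq_mul,
      mul_one] at h1 h2
    linarith [S.wLow_pos i]
  have h1 := mul_nonneg S.γ_mem.1.le (h 0)
  have h2 := mul_nonneg (sub_nonneg.2 S.γ_mem.2) (h 1)
  unfold cWHigh
  linarith

lemma cΓLow_pos : 0 < S.cΓLow := by
  have := S.σLow_pos
  unfold cΓLow
  positivity

/-- Lowering the lower bound on `G(k)⁻¹` makes the residual `ε̃` as large as desired. -/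
lemma le_epsTilde {gLow gHigh cC K : ℝ} (hg : 0 < gLow) (hG : 0 ≤ gHigh) (hK : 0 < K)
    (h : gLow ≤ cC / (S.cΓLow * K)) : K ≤ S.epsTilde gLow gHigh cC := by
  have hΓ := S.cΓLow_pos
  have h1 : 0 ≤ 3 / S.cALow * gHigh * S.cBHigh * S.cWHigh := by
    have := S.cALow_pos
    have := S.cWHigh_nonneg
    unfold cBHigh
    positivity
  have h2 : K ≤ cC / (S.cΓLow * gLow) := by
    rw [le_div_iff₀ (by positivity)] at h ⊢
    linarith
  unfold epsTilde
  linarith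

end Setup

/-- What the pathwise analysis of the filter yields for an error sequence: the cost-to-arrive `V`
is equivalent to the squared error, contracts over windows of length `L`, and grows in between by no
more than the disturbances `n`. -/
structure PathwiseBounds (L : ℕ) (g G c C : ℝ) (V E n : ℕ → ℝ) : Prop where
  lower : ∀ k, g * E k ≤ V k
  upper : ∀ k, V k ≤ G * E k
  growth : ∀ k, V (k + 1) ≤ V k + C * n k
  contraction : ∀ k, V (k + L) ≤ (1 - c) * V k + ∑ j ∈ Finset.range L, C * n (k + j)

lemma PathwiseBounds.le_geom {L : ℕ} {g G c C : ℝ} {V E n : ℕ → ℝ}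
    (h : PathwiseBounds L g G c C V E n) (hc : c ≤ 1) (k b m : ℕ) :
    g * E (k + b + m * L) ≤
      (1 - c) ^ m * (G * E k + ∑ j ∈ Finset.range b, C * n (k + j)) +
        ∑ i ∈ Finset.range m, (1 - c) ^ i *
          ∑ j ∈ Finset.range L, C * n (k + b + (m - 1 - i) * L + j) := by
  have h2 : V (k + b) ≤ V k + ∑ j ∈ Finset.range b, C * n (k + j) := by
    induction b with
    | zero => simp
    | succ b ih =>
      rw [Finset.sum_range_succ, ← add_assoc]
      linarith [h.growth (k + b)]
  have h1 := le_geom_of_contraction (V := V)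
    (n := fun k => ∑ j ∈ Finset.range L, C * n (k + j)) hc h.contraction (k + b) m
  have h3 := mul_le_mul_of_nonneg_left (h2.trans (add_le_add_left (h.upper k) _))
    (pow_nonneg (sub_nonneg.2 hc) m)
  linarith [h.lower (k + b + m * L)]

section Integration

variable {Ω : Type*} [MeasurableSpace Ω] {P : Measure Ω}

/-- Integration of the pathwise bounds, which are linear in the squared error and in the energies
of the disturbances. -/
lemma integral_le_geom {L : ℕ} {g G c C D : ℝ} (hc : c ≤ 1) (hC : 0 ≤ C)
    {E n : ℕ → Ω → ℝ}
    (h : ∀ᵐ ω ∂P, ∃ V : ℕ → ℝ, PathwiseBounds L g G c C V (fun k => E k ω) (fun k => n k ω))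
    (hE : ∀ k, Integrable (E k) P) (hn : ∀ k, Integrable (n k) P)
    (hD : ∀ k, ∫ ω, n k ω ∂P ≤ D) (k b m : ℕ) :
    g * ∫ ω, E (k + b + m * L) ω ∂P ≤
      (1 - c) ^ m * (G * ∫ ω, E k ω ∂P + b * (C * D)) +
        (∑ i ∈ Finset.range m, (1 - c) ^ i) * (L * (C * D)) := by
  have hsum : ∀ r s, Integrable (fun ω => ∑ j ∈ Finset.range r, C * n (s + j) ω) P := fun r s =>
    integrable_finsetSum _ fun j _ => (hn _).const_mul C
  have hsumle : ∀ r s, ∫ ω, ∑ j ∈ Finset.range r, C * n (s + j) ω ∂P ≤ r * (C * D) := by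
    intro r s
    rw [integral_finsetSum _ fun j _ => (hn _).const_mul C]
    refine (Finset.sum_le_sum fun j _ => ?_).trans_eq
      ((Finset.sum_const (C * D)).trans (by rw [Finset.card_range, nsmul_eq_mul]))
    rw [integral_const_mul]
    exact mul_le_mul_of_nonneg_left (hD _) hC
  have hfirst : Integrable (fun ω => (1 - c) ^ m *
      (G * E k ω + ∑ j ∈ Finset.range b, C * n (k + j) ω)) P :=
    (((hE k).const_mul G).add (hsum b k)).const_mul _
  have hterm : ∀ i, Integrable (fun ω => (1 - c) ^ i *
      ∑ j ∈ Finset.range L, C * n (k + b + (m - 1 - i) * L + j) ω) P :=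
    fun i => (hsum L _).const_mul _
  have hlast : Integrable (fun ω => ∑ i ∈ Finset.range m, (1 - c) ^ i *
      ∑ j ∈ Finset.range L, C * n (k + b + (m - 1 - i) * L + j) ω) P :=
    integrable_finsetSum _ fun i _ => hterm i
  have hmono : ∫ ω, g * E (k + b + m * L) ω ∂P ≤
      ∫ ω, ((1 - c) ^ m * (G * E k ω + ∑ j ∈ Finset.range b, C * n (k + j) ω) +
        ∑ i ∈ Finset.range m, (1 - c) ^ i *
          ∑ j ∈ Finset.range L, C * n (k + b + (m - 1 - i) * L + j) ω) ∂P := by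
    refine integral_mono_ae ((hE _).const_mul g) (hfirst.add hlast) ?_
    filter_upwards [h] with ω ⟨V, hV⟩
    exact hV.le_geom hc k b m
  rw [integral_const_mul, integral_add hfirst hlast, integral_const_mul,
    integral_add ((hE k).const_mul G) (hsum b k), integral_const_mul,
    integral_finsetSum _ fun i _ => hterm i] at hmono
  refine hmono.trans (add_le_add ?_ ?_)
  · refine mul_le_mul_of_nonneg_left ?_ (pow_nonneg (sub_nonneg.2 hc) m)
    linarith [hsumle b k]
  · rw [Finset.sum_mul]
    refine Finset.sum_le_sum fun i _ => ?_
    rw [integral_const_mul]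
    exact mul_le_mul_of_nonneg_left (hsumle L _) (pow_nonneg (sub_nonneg.2 hc) i)

end Integration

namespace ClosedLoop

variable {S : Setup} {Ω : Type*} [MeasurableSpace Ω] {P : Measure Ω} (L : ClosedLoop S P)

lemma memLp_err {g G C : ℝ} (hg : 0 < g)
    (h : ∀ᵐ ω ∂P, ∀ k, g * ‖L.err (k + 1) ω‖ ^ 2 ≤
      G * ‖L.err k ω‖ ^ 2 + C * L.disturbance k ω) (k : ℕ) : MemLp (L.err k) 2 P := by
  induction k with
  | zero => exact L.initial_memLp
  | succ k ih =>
    rw [memLp_two_iff_integrable_sq_norm (L.measurable_err _).aestronglyMeasurable] at ih ⊢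
    refine Integrable.mono'
      (((ih.const_mul G).add ((L.integrable_disturbance k).const_mul C)).const_mul (1 / g))
      ((L.measurable_err _).norm.pow_const 2).aestronglyMeasurable ?_
    filter_upwards [h] with ω hω
    rw [Real.norm_of_nonneg (sq_nonneg _), one_div, inv_mul_eq_div, le_div_iff₀ hg, mul_comm]
    exact hω k

end ClosedLoop

end

end Encirclement

theorem theorem1 (S : Encirclement.Setup) :
    ∃ (M : ℕ) (gLow gHigh cα cC : ℝ),
      2 ≤ M ∧ 0 < gLow ∧ 0 < gHigh ∧ 0 < cα ∧ cα ≤ 1 ∧ 0 < cC ∧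
      ∀ (Ω : Type*) [MeasurableSpace Ω] (P : Measure Ω) [IsProbabilityMeasure P]
        (L : Encirclement.ClosedLoop S P),
        (∀ᵐ ω ∂P, ∀ k : ℕ,
          ‖L.relPos k ω‖ ^ 2 ≤ cC ∧
          gLow • (1 : Encirclement.StateMatrix) ≤ (L.var k ω)⁻¹ ∧
          (L.var k ω)⁻¹ ≤ gHigh • (1 : Encirclement.StateMatrix)) ∧
        (∀ k : ℕ, MemLp (L.err k) 2 P) ∧
        (∀ ℓ k : ℕ, ℓ * (M - 1) ≤ k →
          L.meanSqErr k ≤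
            ((1 - cα) ^ ℓ * gHigh * L.meanSqErr (k - ℓ * (M - 1)) +
              (∑ i ∈ Finset.range ℓ, (1 - cα) ^ i) * S.epsTilde gLow gHigh cC) * gLow⁻¹) ∧
        (∀ ℓ k : ℕ, ℓ * (M - 1) ≤ k →
          L.meanSqErr k ≤
            (1 - cα) ^ ℓ * gHigh * gLow⁻¹ * L.meanSqErr 0 +
              gLow⁻¹ * ((∑ i ∈ Finset.range ℓ, (1 - cα) ^ i) + ((M : ℝ) - 2)) *
                S.epsTilde gLow gHigh cC) := by
  open Encirclement in
  obtain ⟨Q, a, N, hQ, ha, hexc⟩ := S.exists_excites_relPos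
  obtain ⟨T, g, G, c, C, hT, hg, hG, hc, hc1, hC, hfilter⟩ := S.exists_contraction Q ha N
  have hD := S.disturbanceBound_nonneg
  set R := (T : ℝ) * (C * S.disturbanceBound) with hR
  have hR0 : 0 ≤ R := by positivity
  set K := R + R / c + 1 with hK
  have hRc : 0 ≤ R / c := by positivity
  have hK0 : 0 < K := by positivity
  have hΓ := S.cΓLow_pos
  -- `gLow` is taken so small that `ε̃` exceeds the accumulated mean energy of the disturbances
  set g' := min g (Q ^ 2 / (S.cΓLow * K)) with hg'
  have hg'0 : 0 < g' := lt_min hg (by positivity)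
  have heps : K ≤ S.epsTilde g' G (Q ^ 2) := S.le_epsTilde hg'0 hG.le hK0 (min_le_right _ _)
  set ε := S.epsTilde g' G (Q ^ 2) with hε
  have hε0 : 0 < ε := hK0.trans_le heps
  have hc0 : 0 ≤ 1 - c := sub_nonneg.2 hc1
  have hT2 : (2 : ℝ) ≤ T := by exact_mod_cast hT
  refine ⟨T + 1, g', G, c, Q ^ 2, by omega, hg'0, hG, hc, hc1, by positivity, ?_⟩
  intro Ω _ P _ L
  have hpath : ∀ᵐ ω ∂P, ∃ V : ℕ → ℝ, PathwiseBounds T g G c C V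
      (fun k => ‖L.err k ω‖ ^ 2) (fun k => L.disturbance k ω) := by
    filter_upwards [hexc L] with ω hω
    obtain ⟨h1, h2⟩ := hfilter _ hω
    obtain ⟨h3, h4⟩ := h2 (fun k => L.err k ω) (fun k => L.acc 1 k ω)
      (fun k => L.obsNoise k ω) (fun k => L.err_succ k ω)
    exact ⟨fun k => S.lyap (fun m => L.relPos m ω) k (L.err k ω),
      fun k => (h1 k _).1, fun k => (h1 k _).2, h3, h4⟩
  have hmem : ∀ k, MemLp (L.err k) 2 P := by
    refine L.memLp_err (G := G) (C := C) hg ?_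
    filter_upwards [hpath] with ω ⟨V, hV⟩ k
    have h1 := hV.lower (k + 1)
    have h2 := hV.upper k
    have h3 := hV.growth k
    linarith
  have hE0 : ∀ k, 0 ≤ L.meanSqErr k := fun k => integral_nonneg fun ω => sq_nonneg _
  have hint : ∀ k b m, g' * L.meanSqErr (k + b + m * T) ≤
      (1 - c) ^ m * (G * L.meanSqErr k + b * (C * S.disturbanceBound)) +
        (∑ i ∈ Finset.range m, (1 - c) ^ i) * R := fun k b m =>
    (mul_le_mul_of_nonneg_right (min_le_left _ _) (hE0 _)).trans
      (integral_le_geom hc1 hC.le hpath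
        (fun k => (memLp_two_iff_integrable_sq_norm
          (L.measurable_err k).aestronglyMeasurable).1 (hmem k))
        L.integrable_disturbance L.integral_disturbance_le k b m)
  have hsum0 : ∀ m, 0 ≤ ∑ i ∈ Finset.range m, (1 - c) ^ i := fun m =>
    Finset.sum_nonneg fun i _ => pow_nonneg hc0 i
  refine ⟨?_, hmem, ?_, ?_⟩
  · filter_upwards [hexc L] with ω hω k
    have hbd := (hfilter _ hω).1
    have hherm := (S.filterVar_posDef (fun m => L.relPos m ω) k).inv.isHermitian
    refine ⟨pow_le_pow_left₀ (norm_nonneg _) (hω.1 k) 2,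
      smul_one_le_of_quadForm hherm fun X => ?_, le_smul_one_of_quadForm hherm fun X => (hbd k X).2⟩
    exact (mul_le_mul_of_nonneg_right (min_le_left _ _) (sq_nonneg _)).trans (hbd k X).1
  · intro ℓ k hk
    rw [Nat.add_sub_cancel] at hk ⊢
    have h1 := hint (k - ℓ * T) 0 ℓ
    rw [add_zero, Nat.sub_add_cancel hk, Nat.cast_zero, zero_mul, add_zero] at h1
    have h2 := mul_le_mul_of_nonneg_left (show R ≤ ε by linarith) (hsum0 ℓ)
    rw [← div_eq_mul_inv, le_div_iff₀ hg'0]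
    linarith
  · intro ℓ k hk
    rw [Nat.add_sub_cancel] at hk
    -- the window of `ℓ` contractions is extended as far down as possible
    have h1 := hint 0 (k % T) (k / T)
    rw [zero_add, mul_comm (k / T) T, Nat.mod_add_div] at h1
    have h2 : ℓ ≤ k / T := (Nat.le_div_iff_mul_le (by omega)).2 hk
    have h3 : (1 - c) ^ (k / T) ≤ (1 - c) ^ ℓ :=
      pow_le_pow_of_le_one hc0 (by linarith) h2
    have h4 : ((k % T : ℕ) : ℝ) * (C * S.disturbanceBound) ≤ R := by
      rw [hR]
      gcongr
      exact (Nat.mod_lt _ (by omega)).le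
    have h5 : (1 - c) ^ (k / T) ≤ 1 := pow_le_one₀ hc0 (by linarith)
    have h6 : 0 ≤ ((k % T : ℕ) : ℝ) * (C * S.disturbanceBound) := by positivity
    have h7 : (1 - c) ^ (k / T) * (G * L.meanSqErr 0) ≤ (1 - c) ^ ℓ * (G * L.meanSqErr 0) :=
      mul_le_mul_of_nonneg_right h3 (mul_nonneg hG.le (hE0 0))
    have h8 := mul_le_of_le_one_left h6 h5
    have h9 : (∑ i ∈ Finset.range (k / T), (1 - c) ^ i) * R ≤ 1 / c * R :=
      mul_le_mul_of_nonneg_right (sum_pow_le_inv hc hc1 _) hR0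
    have h10 : 1 / c * R = R / c := by ring
    have h11 : ε ≤ ((∑ i ∈ Finset.range ℓ, (1 - c) ^ i) + (((T + 1 : ℕ) : ℝ) - 2)) * ε := by
      refine le_mul_of_one_le_left hε0.le ?_
      push_cast
      linarith [hsum0 ℓ]
    have h12 : (1 - c) ^ ℓ * G * g'⁻¹ * L.meanSqErr 0 +
        g'⁻¹ * ((∑ i ∈ Finset.range ℓ, (1 - c) ^ i) + (((T + 1 : ℕ) : ℝ) - 2)) * ε =
        ((1 - c) ^ ℓ * (G * L.meanSqErr 0) +
          ((∑ i ∈ Finset.range ℓ, (1 - c) ^ i) + (((T + 1 : ℕ) : ℝ) - 2)) * ε) / g' := by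
      field_simp
    rw [h12, le_div_iff₀ hg'0]
    linarith
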